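/- Let $\Omega$ be either the torus $\mathbb T^3=(\mathbb R/2\pi\mathbb Z)^3$ or a nonempty bounded open subset of $\mathbb R^3$. All fields are $\mathbb R^3$-valued, and for $F,G\in L^2(\Omega)$ the relation $\nabla\times F=G$ is understood in the sense of distributions on $\Omega$. For $\Omega=\mathbb T^3$ put $$L^2_{\rm curl}(\Omega)=\{B\in L^2(\Omega): B=\nabla\times A \text{ for some } A\in L^2(\Omega)\}.$$ For $\Omega\subset\mathbb R^3$ bounded and open, let $L^2_{\rm curl}(\Omega)$ be the set of the $B\in L^2(\Omega)$ such that $B=\nabla\times A$ for some $A\in L^2(\Omega)$ and such that $B$ satisfies the zero boundary condition, meaning that $B$ is a limit in $L^2(\Omega)$ of fields $\nabla\times\varphi$ with $\varphi\in C_c^\infty(\Omega;\mathbb R^3)$. Let $\omega=\nabla\times u\in L^2_{\rm curl}(\Omega)$ with $u\in L^2(\Omega)$, let $h_1,h_2\in\mathbb R\setminus\{0\}$, and let $\mathcal A_\omega^{h_1,h_2}(\Omega)$ be the set of all $B=\nabla\times A\in L^2_{\rm curl}(\Omega)$, $A\in L^2(\Omega)$, with magnetic helicity and magneto-vorticity helicity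 $$\int_\Omega A\cdot B\,dx=h_1,\qquad \int_\Omega (A+u)\cdot(B+\omega)\,dx=h_2$$ (these integrals do not depend on the choice of $A$). (i) If $\omega\neq0$ or $h_1=h_2$, then the magnetic energy $\int_\Omega|B|^2\,dx$ attains its minimum over $\mathcal A_\omega^{h_1,h_2}(\Omega)$; in particular this set is not empty. (If $\omega=0$ and $h_1\neq h_2$, it is empty.) (ii) For every minimizer $B$ there are $\lambda_1,\lambda_2\in\mathbb R$ such that $\nabla\times B-\lambda_1B-\lambda_2(B+\omega)=0$ in the sense of distributions on $\Omega$. -/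

import Mathlib

open MeasureTheory

noncomputable section

namespace HallMHD

/-- Euclidean three-space. -/
abbrev E3 : Type := EuclideanSpace ℝ (Fin 3)

/-- `∂ᵢ Fⱼ (x)`, the `i`-th partial derivative of the `j`-th component of `F`. -/
def partialD (F : E3 → E3) (i j : Fin 3) (x : E3) : ℝ :=
  fderiv ℝ F x (EuclideanSpace.single i 1) j

/-- The classical curl `∇ × F` of a differentiable vector field. -/
def curl (F : E3 → E3) (x : E3) : E3 :=
  !₂[partialD F 1 2 x - partialD F 2 1 x,
     partialD F 2 0 x - partialD F 0 2 x,
     partialD F 0 1 x - partialD F 1 0 x]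

/-- The domains considered: the flat torus `𝕋³ = (ℝ/2πℤ)³`, or a nonempty bounded open subset
of `ℝ³`. No regularity of the boundary is required. -/
inductive Dom : Type where
  | torus : Dom
  | bounded (Ω : Set E3) (isOpen : IsOpen Ω) (isBounded : Bornology.IsBounded Ω)
      (nonempty : Ω.Nonempty) : Dom

namespace Dom

/-- The set over which one integrates: the fundamental cube `(-π, π]³` of the torus, or the open
set itself. A field on the torus is represented by its values on the fundamental cube. -/
def carrier : Dom → Set E3
  | torus => {x | ∀ i, x i ∈ Set.Ioc (-Real.pi) Real.pi}
  | bounded Ω _ _ _ => Ω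

/-- Lebesgue measure on the domain. -/
def measure (D : Dom) : Measure E3 := volume.restrict D.carrier

/-- Smooth test vector fields: on the torus, the smooth fields that are `2π`-periodic in every
variable; on an open set, the smooth fields with compact support in that set. -/
def IsTest : Dom → (E3 → E3) → Prop
  | torus, φ => ContDiff ℝ (⊤ : ℕ∞) φ ∧
      ∀ (i : Fin 3) (x : E3), φ (x + EuclideanSpace.single i (2 * Real.pi)) = φ x
  | bounded Ω _ _ _, φ => ContDiff ℝ (⊤ : ℕ∞) φ ∧ HasCompactSupport φ ∧ tsupport φ ⊆ Ω

/-- Square-integrable vector fields on the domain. -/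
def IsL2 (D : Dom) (F : E3 → E3) : Prop := MemLp F 2 D.measure

/-- `∇ × F = G` on the domain, in the sense of distributions. -/
def HasWeakCurl (D : Dom) (F G : E3 → E3) : Prop :=
  ∀ φ : E3 → E3, D.IsTest φ →
    ∫ x, inner ℝ (F x) (curl φ x) ∂D.measure = ∫ x, inner ℝ (G x) (φ x) ∂D.measure

/-- `A` is a square-integrable vector potential of `B`. -/
def IsPotential (D : Dom) (A B : E3 → E3) : Prop := D.IsL2 A ∧ D.HasWeakCurl A B

/-- The zero boundary condition. There is none on the torus. On an open set it is imposed in the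
usual way by density: `B` is a limit in `L²` of fields `∇ × φ` with `φ` smooth and compactly
supported. It contains `B · n = 0` on the boundary, and makes the integral of `A · B` independent
of the choice of the vector potential `A` of `B`. -/
def ZeroBoundary : (D : Dom) → (E3 → E3) → Prop
  | torus, _ => True
  | D@(bounded _ _ _ _), B => ∀ ε : ℝ, 0 < ε →
      ∃ φ : E3 → E3, D.IsTest φ ∧ ∫ x, ‖B x - curl φ x‖ ^ 2 ∂D.measure < ε

/-- The space `L²_curl` of the square-integrable fields `B = ∇ × A` with `A` square-integrable,
with zero boundary condition on an open set. -/
def L2curl (D : Dom) : Set (E3 → E3) :=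
  {B | D.IsL2 B ∧ (∃ A, D.IsPotential A B) ∧ D.ZeroBoundary B}

/-- The magnetic energy `∫ |B|²`. -/
def energy (D : Dom) (B : E3 → E3) : ℝ := ∫ x, ‖B x‖ ^ 2 ∂D.measure

/-- The helicity `∫ A · B` of a field `B` with vector potential `A`. -/
def helicity (D : Dom) (A B : E3 → E3) : ℝ := ∫ x, inner ℝ (A x) (B x) ∂D.measure

/-- The fields `B = ∇ × A` in `L²_curl` with magnetic helicity `∫ A · B = h₁` and magneto-vorticity
helicity `∫ (A + u) · (B + ω) = h₂`, where `ω = ∇ × u` is prescribed. Neither integral depends on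
the choice of the potential `A` of `B`. -/
def admissible (D : Dom) (u ω : E3 → E3) (h₁ h₂ : ℝ) : Set (E3 → E3) :=
  {B | B ∈ D.L2curl ∧
    ∃ A, D.IsPotential A B ∧ D.helicity A B = h₁ ∧ D.helicity (A + u) (B + ω) = h₂}

/-- `B` minimizes the magnetic energy over the admissible fields. -/
def IsMinimizer (D : Dom) (u ω : E3 → E3) (h₁ h₂ : ℝ) (B : E3 → E3) : Prop :=
  B ∈ D.admissible u ω h₁ h₂ ∧ ∀ B' ∈ D.admissible u ω h₁ h₂, D.energy B ≤ D.energy B'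

end Dom

end HallMHD

end

open Filter Topology

noncomputable section

section Hilbert

variable {X : Type*} [NormedAddCommGroup X] [InnerProductSpace ℝ X]

/-- Bounded sequences in a Hilbert space converge weakly along ultrafilters. -/
theorem exists_weak_limit_ultrafilter [CompleteSpace X] (U : Ultrafilter ℕ) (x : ℕ → X) (R : ℝ)
    (hR : ∀ n, ‖x n‖ ≤ R) :
    ∃ a : X, ∀ v : X, Tendsto (fun n => inner ℝ v (x n)) U (𝓝 (inner ℝ v a)) := by
  let f : ℕ → WeakDual ℝ X := fun n => StrongDual.toWeakDual (InnerProductSpace.toDual ℝ X (x n))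
  have hc := WeakDual.isCompact_closedBall (𝕜 := ℝ) (E := X) 0 R
  obtain ⟨g, -, hg⟩ := hc.ultrafilter_le_nhds' (U.map f) (by
    rw [Ultrafilter.mem_map]
    exact Filter.univ_mem' fun n => by simpa [f] using hR n)
  refine ⟨(InnerProductSpace.toDual ℝ X).symm (WeakDual.toStrongDual g), fun v => ?_⟩
  have h1 : Tendsto f U (𝓝 g) := hg
  have h2 := ((WeakDual.eval_continuous v).tendsto g).comp h1
  rw [real_inner_comm, InnerProductSpace.toDual_symm_apply]
  refine h2.congr fun n => ?_
  simp only [Function.comp, f]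
  rw [real_inner_comm]
  rfl

/-- A quantitative form of compactness of a linear map. -/
def AlmostFiniteRank (K : X →L[ℝ] X) : Prop :=
  ∀ ε : ℝ, 0 < ε → ∃ (ι : Type) (s : Finset ι) (v : ι → X),
    ∀ x, ‖K x‖ ≤ ε * ‖x‖ + ∑ i ∈ s, |inner ℝ (v i) x|

theorem AlmostFiniteRank.tendsto {K : X →L[ℝ] X} (hK : AlmostFiniteRank K) {l : Filter ℕ}
    {x : ℕ → X} {a : X} {R : ℝ} (hR : ∀ n, ‖x n‖ ≤ R)
    (hx : ∀ v : X, Tendsto (fun n => inner ℝ v (x n)) l (𝓝 (inner ℝ v a))) :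
    Tendsto (fun n => K (x n)) l (𝓝 (K a)) := by
  rw [tendsto_iff_norm_sub_tendsto_zero, Metric.tendsto_nhds]
  intro ε hε
  have hR0 : 0 ≤ R := (norm_nonneg _).trans (hR 0)
  have hM : 0 < R + ‖a‖ + 1 := by positivity
  obtain ⟨ι, s, v, hs⟩ := hK (ε / 2 / (R + ‖a‖ + 1)) (by positivity)
  have h1 : Tendsto (fun n => ∑ i ∈ s, |inner ℝ (v i) (x n - a)|) l (𝓝 0) := by
    have : Tendsto (fun n => ∑ i ∈ s, |inner ℝ (v i) (x n - a)|) l (𝓝 (∑ i ∈ s, |(0:ℝ)|)) := by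
      refine tendsto_finsetSum _ fun i _ => Tendsto.abs ?_
      have := (hx (v i)).sub_const (inner ℝ (v i) a)
      simpa [inner_sub_right] using this
    simpa using this
  filter_upwards [h1.eventually (gt_mem_nhds (half_pos hε))] with n hn
  rw [Real.dist_eq, sub_zero, abs_norm, ← map_sub]
  refine (hs _).trans_lt ?_
  have h2 : ε / 2 / (R + ‖a‖ + 1) * ‖x n - a‖ ≤ ε / 2 := by
    rw [div_mul_eq_mul_div, div_le_iff₀ hM]
    have : ‖x n - a‖ ≤ R + ‖a‖ + 1 := by linarith [norm_sub_le (x n) a, hR n]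
    gcongr
  linarith

theorem AlmostFiniteRank.tendsto_inner {K : X →L[ℝ] X} (hK : AlmostFiniteRank K) {l : Filter ℕ}
    {x : ℕ → X} {a : X} {R : ℝ} (hR : ∀ n, ‖x n‖ ≤ R)
    (hx : ∀ v : X, Tendsto (fun n => inner ℝ v (x n)) l (𝓝 (inner ℝ v a))) :
    Tendsto (fun n => inner ℝ (K (x n)) (x n)) l (𝓝 (inner ℝ (K a) a)) := by
  have h0 := tendsto_iff_norm_sub_tendsto_zero.1 (hK.tendsto hR hx)
  have h1 : Tendsto (fun n => inner ℝ (K (x n) - K a) (x n)) l (𝓝 0) := by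
    refine squeeze_zero_norm (fun n => ?_) (by simpa using h0.mul_const R)
    exact (norm_inner_le_norm _ _).trans (by gcongr; exact hR n)
  have := h1.add (hx (K a))
  simpa [inner_sub_left] using this

/-- The norm attains its minimum on a nonempty level set of two shifted compact quadratic forms. -/
theorem AlmostFiniteRank.exists_min_norm [CompleteSpace X] {K : X →L[ℝ] X}
    (hK : AlmostFiniteRank K) (w : X) (h₁ h₂ : ℝ)
    (hne : ∃ x, inner ℝ (K x) x = h₁ ∧ inner ℝ (K (x + w)) (x + w) = h₂) :
    ∃ x, (inner ℝ (K x) x = h₁ ∧ inner ℝ (K (x + w)) (x + w) = h₂) ∧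
      ∀ y, (inner ℝ (K y) y = h₁ ∧ inner ℝ (K (y + w)) (y + w) = h₂) → ‖x‖ ≤ ‖y‖ := by
  set S : Set X := {x | inner ℝ (K x) x = h₁ ∧ inner ℝ (K (x + w)) (x + w) = h₂}
  have hbdd : BddBelow (norm '' S) := ⟨0, by rintro _ ⟨x, -, rfl⟩; exact norm_nonneg x⟩
  have hne' : (norm '' S).Nonempty := Set.Nonempty.image _ hne
  set m := sInf (norm '' S)
  obtain ⟨r, hr_anti, hr, hrS⟩ := exists_seq_tendsto_sInf hne' hbdd
  choose x hxS hxr using hrS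
  have hR : ∀ n, ‖x n‖ ≤ r 0 := fun n => by rw [hxr]; exact hr_anti (Nat.zero_le n)
  let U : Ultrafilter ℕ := hyperfilter ℕ
  have hU : (U : Filter ℕ) ≤ atTop := Nat.hyperfilter_le_atTop
  obtain ⟨a, ha⟩ := exists_weak_limit_ultrafilter U x _ hR
  have haS : a ∈ S := by
    constructor
    · refine tendsto_nhds_unique (l := (U : Filter ℕ)) (hK.tendsto_inner hR ha) ?_
      simp_rw [fun n => (hxS n).1]
      exact tendsto_const_nhds
    · have h3 : ∀ n, ‖x n + w‖ ≤ r 0 + ‖w‖ := fun n => (norm_add_le _ _).trans (by gcongr; exact hR n)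
      refine tendsto_nhds_unique (l := (U : Filter ℕ))
        (hK.tendsto_inner (a := a + w) h3 fun v => ?_) ?_
      · simp_rw [inner_add_right]
        exact (ha v).add_const _
      · simp_rw [fun n => (hxS n).2]
        exact tendsto_const_nhds
  have ham : ‖a‖ ≤ m := by
    have h4 : Tendsto (fun n => ‖a‖ * ‖x n‖) U (𝓝 (‖a‖ * m)) := by
      simp_rw [hxr]
      exact (hr.mono_left hU).const_mul _
    have h5 := le_of_tendsto_of_tendsto' (ha a) h4 fun n => real_inner_le_norm _ _
    rw [real_inner_self_eq_norm_mul_norm] at h5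
    rcases (norm_nonneg a).eq_or_lt with h | h
    · rw [← h]
      exact le_csInf hne' (by rintro _ ⟨y, -, rfl⟩; exact norm_nonneg y)
    · exact le_of_mul_le_mul_left h5 h
  exact ⟨a, haS, fun y hy => ham.trans (csInf_le hbdd ⟨y, hy, rfl⟩)⟩

/-- The quadratic form of `K` takes values of both signs on every closed hyperplane. -/
def IndefiniteOnHyperplanes (K : X →L[ℝ] X) : Prop :=
  ∀ m : X, (∃ v, inner ℝ m v = 0 ∧ 0 < inner ℝ (K v) v) ∧
    (∃ v, inner ℝ m v = 0 ∧ inner ℝ (K v) v < 0)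

theorem inner_map_add_smul {K : X →L[ℝ] X} (hs : ∀ x y, inner ℝ (K x) y = inner ℝ x (K y))
    (x v : X) (t : ℝ) : inner ℝ (K (x + t • v)) (x + t • v) =
      inner ℝ (K x) x + 2 * t * inner ℝ (K x) v + t ^ 2 * inner ℝ (K v) v := by
  have : inner ℝ (K v) x = inner ℝ (K x) v := by rw [hs, real_inner_comm]
  simp only [map_add, map_smul, inner_add_left, inner_add_right, inner_smul_left,
    inner_smul_right, this, RCLike.conj_to_real]
  ring

theorem inner_map_add {K : X →L[ℝ] X} (hs : ∀ x y, inner ℝ (K x) y = inner ℝ x (K y))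
    (x v : X) : inner ℝ (K (x + v)) (x + v) =
      inner ℝ (K x) x + 2 * inner ℝ (K x) v + inner ℝ (K v) v := by
  simpa using inner_map_add_smul hs x v 1

/-- A quadratic polynomial with opposite signs of the extreme coefficients has roots of
both signs. -/
theorem exists_roots_quadratic {a b c : ℝ} (h : a * c < 0) :
    ∃ s t : ℝ, s < 0 ∧ 0 < t ∧ c + 2 * s * b + s ^ 2 * a = 0 ∧ c + 2 * t * b + t ^ 2 * a = 0 := by
  have hd : b ^ 2 < b ^ 2 - a * c := by linarith
  have ha : a ≠ 0 := by rintro rfl; simp at h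
  set d := √(b ^ 2 - a * c) with hd'
  have hdd : d ^ 2 = b ^ 2 - a * c := Real.sq_sqrt (by nlinarith [sq_nonneg b])
  have hd1 : |b| < d := by
    rw [hd', ← Real.sqrt_sq_eq_abs]
    exact Real.sqrt_lt_sqrt (sq_nonneg b) hd
  obtain ⟨h1, h2⟩ := abs_lt.1 hd1
  have r1 : c + 2 * ((-b - d) / a) * b + ((-b - d) / a) ^ 2 * a = 0 := by
    field_simp; nlinarith
  have r2 : c + 2 * ((-b + d) / a) * b + ((-b + d) / a) ^ 2 * a = 0 := by
    field_simp; nlinarith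
  rcases lt_or_gt_of_ne ha with ha | ha
  · exact ⟨_, _, div_neg_of_pos_of_neg (by linarith) ha, div_pos_of_neg_of_neg (by linarith) ha,
      r2, r1⟩
  · exact ⟨_, _, div_neg_of_neg_of_pos (by linarith) ha, div_pos (by linarith) ha, r1, r2⟩

theorem IndefiniteOnHyperplanes.exists_level {K : X →L[ℝ] X} (hi : IndefiniteOnHyperplanes K)
    (hs : ∀ x y, inner ℝ (K x) y = inner ℝ x (K y)) (m x₀ : X) (h : ℝ) :
    ∃ x, inner ℝ m x = inner ℝ m x₀ ∧ inner ℝ (K x) x = h := by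
  obtain ⟨⟨p, hp, hp'⟩, n, hn, hn'⟩ := hi m
  have key : ∀ v, inner ℝ m v = 0 → inner ℝ (K v) v * (inner ℝ (K x₀) x₀ - h) < 0 →
      ∃ x, inner ℝ m x = inner ℝ m x₀ ∧ inner ℝ (K x) x = h := by
    intro v hv hv'
    obtain ⟨-, t, -, -, -, ht⟩ := exists_roots_quadratic (b := inner ℝ (K x₀) v) hv'
    refine ⟨x₀ + t • v, by simp [inner_add_right, inner_smul_right, hv], ?_⟩
    rw [inner_map_add_smul hs]
    linarith
  rcases lt_trichotomy (inner ℝ (K x₀) x₀ - h) 0 with h0 | h0 | h0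
  · exact key p hp (mul_neg_of_pos_of_neg hp' h0)
  · exact ⟨x₀, rfl, by linarith⟩
  · exact key n hn (mul_neg_of_neg_of_pos hn' h0)

theorem IndefiniteOnHyperplanes.exists_mem_levels {K : X →L[ℝ] X} (hi : IndefiniteOnHyperplanes K)
    (hs : ∀ x y, inner ℝ (K x) y = inner ℝ x (K y)) (hinj : ∀ x, K x = 0 → x = 0)
    (w : X) (h₁ h₂ : ℝ) (h : w ≠ 0 ∨ h₁ = h₂) :
    ∃ x, inner ℝ (K x) x = h₁ ∧ inner ℝ (K (x + w)) (x + w) = h₂ := by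
  obtain ⟨x₀, hx₀⟩ : ∃ x₀, 2 * inner ℝ (K w) x₀ = h₂ - h₁ - inner ℝ (K w) w := by
    by_cases hw : w = 0
    · refine ⟨0, ?_⟩
      subst hw
      simp only [ne_eq, not_true_eq_false, false_or] at h
      simp [h]
    · have hKw : inner ℝ (K w) (K w) ≠ 0 := fun h' => hw (hinj w (inner_self_eq_zero.1 h'))
      refine ⟨((h₂ - h₁ - inner ℝ (K w) w) / 2 / inner ℝ (K w) (K w)) • K w, ?_⟩
      rw [inner_smul_right]
      field_simp
  obtain ⟨x, hx, hx'⟩ := hi.exists_level hs (K w) x₀ h₁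
  refine ⟨x, hx', ?_⟩
  have : inner ℝ (K x) w = inner ℝ (K w) x := by rw [hs, real_inner_comm]
  rw [inner_map_add hs, hx', this, hx, hx₀]
  ring

/-- If `b` is orthogonal to all isotropic vectors of the hyperplane `(K b)ᗮ`, it is a multiple
of `K b`. -/
theorem IndefiniteOnHyperplanes.eq_smul_of_forall_isotropic {K : X →L[ℝ] X}
    (hi : IndefiniteOnHyperplanes K) (hs : ∀ x y, inner ℝ (K x) y = inner ℝ x (K y)) (b : X)
    (hb : ∀ v, inner ℝ (K b) v = 0 → inner ℝ (K v) v = 0 → inner ℝ b v = 0) :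
    ∃ l : ℝ, b = l • K b := by
  have hperp : ∀ v, inner ℝ (K b) v = 0 → inner ℝ b v = 0 := by
    obtain ⟨⟨p, hp, hp'⟩, n, hn, hn'⟩ := hi (K b)
    intro v hv
    have key : ∀ z, inner ℝ (K b) z = 0 → inner ℝ (K z) z * inner ℝ (K v) v < 0 →
        inner ℝ b v = 0 := by
      intro z hz hz'
      obtain ⟨s, t, hs0, ht0, hs', ht'⟩ := exists_roots_quadratic (b := inner ℝ (K v) z) hz'
      have e1 := hb (v + s • z) (by simp [inner_add_right, inner_smul_right, hz, hv])
        (by rw [inner_map_add_smul hs]; exact hs')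
      have e2 := hb (v + t • z) (by simp [inner_add_right, inner_smul_right, hz, hv])
        (by rw [inner_map_add_smul hs]; exact ht')
      rw [inner_add_right, inner_smul_right] at e1 e2
      have e3 : (t - s) * inner ℝ b z = 0 := by linarith
      rcases mul_eq_zero.1 e3 with h | h
      · linarith
      · simpa [h] using e1
    rcases lt_trichotomy (inner ℝ (K v) v) 0 with h0 | h0 | h0
    · exact key p hp (mul_neg_of_pos_of_neg hp' h0)
    · exact hb v hv h0
    · exact key n hn (mul_neg_of_neg_of_pos hn' h0)
  have : b ∈ (ℝ ∙ K b)ᗮᗮ := by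
    rw [Submodule.mem_orthogonal]
    intro v hv
    rw [Submodule.mem_orthogonal_singleton_iff_inner_right] at hv
    rw [real_inner_comm]
    exact hperp v hv
  rw [Submodule.orthogonal_orthogonal, Submodule.mem_span_singleton] at this
  obtain ⟨l, hl⟩ := this
  exact ⟨l, hl.symm⟩

theorem hasStrictFDerivAt_inner_map {K : X →L[ℝ] X}
    (hs : ∀ x y, inner ℝ (K x) y = inner ℝ x (K y)) (w x : X) :
    HasStrictFDerivAt (fun y => inner ℝ (K (y + w)) (y + w))
      (2 • innerSL ℝ (K (x + w))) x := by
  have h1 : HasStrictFDerivAt (fun y : X => y + w) (ContinuousLinearMap.id ℝ X) x :=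
    (hasStrictFDerivAt_id x).add_const w
  have h2 := (K.hasStrictFDerivAt.comp x h1).inner ℝ h1
  convert! h2 using 1
  ext v
  simp only [_root_.smul_apply, innerSL_apply_apply, ContinuousLinearMap.comp_apply,
    ContinuousLinearMap.prod_apply, fderivInnerCLM_apply, ContinuousLinearMap.id_apply,
    nsmul_eq_mul, Nat.cast_ofNat, hs v]
  rw [real_inner_comm (K (x + w)) v]
  ring

/-- Euler–Lagrange equation for the norm on the level set of two shifted quadratic forms. -/
theorem IndefiniteOnHyperplanes.exists_multipliers [CompleteSpace X] {K : X →L[ℝ] X}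
    (hi : IndefiniteOnHyperplanes K) (hs : ∀ x y, inner ℝ (K x) y = inner ℝ x (K y))
    (hinj : ∀ x, K x = 0 → x = 0) (w b : X) {h₁ h₂ : ℝ} (hh₁ : h₁ ≠ 0) (hh₂ : h₂ ≠ 0)
    (hb₁ : inner ℝ (K b) b = h₁) (hb₂ : inner ℝ (K (b + w)) (b + w) = h₂)
    (hmin : ∀ y, inner ℝ (K y) y = h₁ → inner ℝ (K (y + w)) (y + w) = h₂ → ‖b‖ ≤ ‖y‖) :
    ∃ l₁ l₂ : ℝ, b = l₁ • K b + l₂ • K (b + w) := by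
  have hb0 : b ≠ 0 := by rintro rfl; simp at hb₁; exact hh₁ hb₁.symm
  have hbw0 : b + w ≠ 0 := by intro h; simp [h] at hb₂; exact hh₂ hb₂.symm
  by_cases hdep : ∃ k : ℝ, w = k • b
  · obtain ⟨k, rfl⟩ := hdep
    have hiso : ∀ v, inner ℝ (K b) v = 0 → inner ℝ (K v) v = 0 → inner ℝ b v = 0 := by
      intro v hv hv'
      have hle : ∀ t : ℝ, 0 ≤ ‖v‖ ^ 2 * (t * t) + 2 * inner ℝ b v * t + 0 := by
        intro t
        have hsum : b + t • v + k • b = (b + k • b) + t • v := by abel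
        have h3 : inner ℝ (K (b + k • b)) v = 0 := by
          simp [inner_add_left, inner_smul_left, hv]
        have := hmin (b + t • v) (by rw [inner_map_add_smul hs, hv, hv', hb₁]; ring)
          (by rw [hsum, inner_map_add_smul hs, hb₂, h3, hv']; ring)
        have h4 := pow_le_pow_left₀ (norm_nonneg b) this 2
        rw [norm_add_sq_real, inner_smul_right, norm_smul, mul_pow, Real.norm_eq_abs, sq_abs] at h4
        linarith
      have := discrim_le_zero hle
      simp only [discrim, mul_zero, sub_zero] at this
      nlinarith [sq_nonneg (inner ℝ b v)]
    obtain ⟨l, hl⟩ := hi.eq_smul_of_forall_isotropic hs b hiso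
    exact ⟨l, 0, by simpa using hl⟩
  · let f : Fin 2 → X → ℝ := ![fun y => inner ℝ (K (y + 0)) (y + 0),
      fun y => inner ℝ (K (y + w)) (y + w)]
    let f' : Fin 2 → StrongDual ℝ X := ![2 • innerSL ℝ (K (b + 0)), 2 • innerSL ℝ (K (b + w))]
    have hf' : ∀ i, HasStrictFDerivAt (f i) (f' i) b := by
      intro i
      fin_cases i
      · exact hasStrictFDerivAt_inner_map hs 0 b
      · exact hasStrictFDerivAt_inner_map hs w b
    have hextr : IsLocalExtrOn (fun y : X => ‖y‖ ^ 2) {y | ∀ i, f i y = f i b} b := by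
      left
      filter_upwards [self_mem_nhdsWithin] with y hy
      have e0 : inner ℝ (K y) y = h₁ := by simpa [f, hb₁] using hy 0
      have e1 : inner ℝ (K (y + w)) (y + w) = h₂ := by
        have := hy 1
        simp only [f, Matrix.cons_val_one, Matrix.cons_val_fin_one] at this
        rw [this, hb₂]
      exact pow_le_pow_left₀ (norm_nonneg b) (hmin y e0 e1) 2
    obtain ⟨Λ, Λ₀, hΛ, hΛf⟩ := hextr.exists_multipliers_of_hasStrictFDerivAt hf'
      (hasStrictFDerivAt_norm_sq b)
    have hsum : Λ 0 • K b + Λ 1 • K (b + w) + Λ₀ • b = 0 := by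
      refine ext_inner_right ℝ fun v => ?_
      have := DFunLike.congr_fun hΛf v
      simp only [f', Fin.sum_univ_two, Matrix.cons_val_zero, Matrix.cons_val_one,
        Matrix.cons_val_fin_one, add_zero, _root_.add_apply,
        _root_.smul_apply, innerSL_apply_apply, nsmul_eq_mul, smul_eq_mul,
        _root_.zero_apply, Nat.cast_ofNat] at this
      simp only [inner_add_left, inner_smul_left, RCLike.conj_to_real, inner_zero_left]
      linarith
    have hΛ₀ : Λ₀ ≠ 0 := by
      rintro rfl
      have h0 : Λ 0 • b + Λ 1 • (b + w) = 0 := hinj _ (by simpa using hsum)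
      by_cases h1 : Λ 1 = 0
      · rw [h1, zero_smul, add_zero] at h0
        have h2 := (smul_eq_zero.1 h0).resolve_right hb0
        refine hΛ (Prod.ext (funext fun i => ?_) rfl)
        fin_cases i
        · exact h2
        · exact h1
      · refine hdep ⟨-(Λ 0 + Λ 1) / Λ 1, ?_⟩
        have : Λ 1 • w = (-(Λ 0 + Λ 1)) • b := by
          rw [smul_add] at h0
          rw [neg_smul, add_smul]
          exact eq_neg_of_add_eq_zero_right (by rw [← h0]; abel)
        rw [div_eq_inv_mul, mul_smul, ← this, inv_smul_smul₀ h1]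
    refine ⟨-Λ 0 / Λ₀, -Λ 1 / Λ₀, ?_⟩
    have : Λ₀ • b = (-Λ 0) • K b + (-Λ 1) • K (b + w) := by
      rw [neg_smul, neg_smul, ← neg_add]
      exact eq_neg_of_add_eq_zero_right hsum
    rw [div_eq_inv_mul, div_eq_inv_mul, mul_smul, mul_smul, ← smul_add, ← this, inv_smul_smul₀ hΛ₀]

end Hilbert

section Construction

variable {H V : Type*} [NormedAddCommGroup H] [InnerProductSpace ℝ H] [CompleteSpace H]
  [AddCommGroup V] [Module ℝ V]

/-- A symmetric operator `S` (composed with an embedding `T`) that satisfies a Rellich type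
estimate has a compact inverse on the closure of its range. -/
theorem exists_compact_inverse (S T : V →ₗ[ℝ] H)
    (hsym : ∀ ψ φ, inner ℝ (S ψ) (T φ) = inner ℝ (T ψ) (S φ)) (hST : ∀ φ, ∃ φ', T φ' = S φ)
    (hE : ∀ ε : ℝ, 0 < ε → ∃ (ι : Type) (s : Finset ι) (v : ι → H), ∀ ψ φ,
      |inner ℝ (S ψ) (T φ)| ≤ (ε * ‖S ψ‖ + ∑ i ∈ s, |inner ℝ (v i) (S ψ)|) * ‖S φ‖) :
    ∃ K : (LinearMap.range S).topologicalClosure →L[ℝ] (LinearMap.range S).topologicalClosure,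
      AlmostFiniteRank K ∧ (∀ x y, inner ℝ (K x) y = inner ℝ x (K y)) ∧
      (∀ x, K x = 0 → x = 0) ∧ ∀ x φ, inner ℝ (K x : H) (S φ) = inner ℝ (x : H) (T φ) := by
  set X := (LinearMap.range S).topologicalClosure with hX
  have hSX : ∀ φ, S φ ∈ X := fun φ => Submodule.le_topologicalClosure _ ⟨φ, rfl⟩
  let e : V →ₗ[ℝ] X := S.codRestrict X hSX
  let f : V →ₗ[ℝ] X := X.orthogonalProjectionOnto.toLinearMap ∘ₗ T
  have he : ∀ φ, (e φ : H) = S φ := fun φ => rfl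
  have hdense : DenseRange e := by
    intro x
    rw [Metric.mem_closure_iff]
    intro ε hε
    have hx : (x : H) ∈ closure (LinearMap.range S : Set H) := x.2
    obtain ⟨_, ⟨φ, rfl⟩, h⟩ := Metric.mem_closure_iff.1 hx ε hε
    exact ⟨e φ, ⟨φ, rfl⟩, h⟩
  have hf : ∀ ψ (x : X), inner ℝ (f ψ) x = inner ℝ (T ψ) (x : H) := fun ψ x => by
    rw [Submodule.coe_inner]
    exact Submodule.inner_orthogonalProjectionOnto_eq_of_mem_right x (T ψ)
  have hest : ∀ (ψ : V) (C : ℝ), 0 ≤ C → (∀ φ, |inner ℝ (S ψ) (T φ)| ≤ C * ‖S φ‖) → ‖f ψ‖ ≤ C := by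
    intro ψ C hC0 hC
    have h1 : ∀ x : X, inner ℝ (f ψ) x ≤ C * ‖x‖ := by
      refine fun x => hdense.induction_on (p := fun x => inner ℝ (f ψ) x ≤ C * ‖x‖) x
        (isClosed_le (by fun_prop) (by fun_prop)) fun φ => ?_
      rw [hf, he, ← hsym]
      exact (le_abs_self _).trans (hC φ)
    have h2 := h1 (f ψ)
    rw [real_inner_self_eq_norm_mul_norm] at h2
    rcases (norm_nonneg (f ψ)).eq_or_lt with h | h
    · rw [← h]
      exact hC0
    · exact le_of_mul_le_mul_right h2 h
  have hbound : ∃ C, ∀ ψ, ‖f ψ‖ ≤ C * ‖e ψ‖ := by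
    obtain ⟨ι, s, v, hs⟩ := hE 1 one_pos
    refine ⟨1 + ∑ i ∈ s, ‖v i‖, fun ψ => ?_⟩
    refine (hest ψ _ (by positivity) (hs ψ)).trans ?_
    rw [add_mul, Finset.sum_mul]
    gcongr with i
    · rfl
    · exact abs_real_inner_le_norm _ _
  let K := f.extendOfNorm e
  have hK : ∀ ψ, K (e ψ) = f ψ := fun ψ => LinearMap.extendOfNorm_eq hdense hbound ψ
  have hKT : ∀ (x : X) φ, inner ℝ (K x : H) (S φ) = inner ℝ (x : H) (T φ) := by
    refine fun x φ => hdense.induction_on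
      (p := fun x : X => inner ℝ (K x : H) (S φ) = inner ℝ (x : H) (T φ)) x
      (isClosed_eq (by fun_prop) (by fun_prop)) fun ψ => ?_
    rw [hK, he, hsym]
    exact hf ψ (e φ)
  refine ⟨K, ?_, ?_, ?_, hKT⟩
  · intro ε hε
    obtain ⟨ι, s, v, hs⟩ := hE ε hε
    refine ⟨ι, s, fun i => X.orthogonalProjectionOnto (v i), fun x => ?_⟩
    refine hdense.induction_on (p := fun x : X => ‖K x‖ ≤ ε * ‖x‖ +
      ∑ i ∈ s, |inner ℝ (X.orthogonalProjectionOnto (v i)) x|) x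
      (isClosed_le (by fun_prop) (by fun_prop)) fun ψ => ?_
    rw [hK]
    refine (hest ψ _ (by positivity) (hs ψ)).trans (le_of_eq ?_)
    congr 1
    refine Finset.sum_congr rfl fun i _ => ?_
    exact congrArg abs (Submodule.inner_orthogonalProjectionOnto_eq_of_mem_right (e ψ) (v i)).symm
  · intro x y
    refine hdense.induction_on₂ (p := fun x y => inner ℝ (K x) y = inner ℝ x (K y))
      (isClosed_eq (by fun_prop) (by fun_prop)) (fun ψ φ => ?_) x y
    rw [hK, hK, hf, he, ← hsym, real_inner_comm (f φ) (e ψ), hf, he, real_inner_comm]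
  · intro x hx
    have h0 : ∀ φ, inner ℝ (x : H) (T φ) = 0 := fun φ => by rw [← hKT, hx]; simp
    have h1 : ∀ y : X, inner ℝ x y = 0 := fun y =>
      hdense.induction_on (p := fun y => inner ℝ x y = 0) y
        (isClosed_eq (by fun_prop) (by fun_prop)) fun φ => by
          obtain ⟨φ', h⟩ := hST φ
          rw [Submodule.coe_inner, he, ← h, h0]
    exact inner_self_eq_zero.1 (h1 x)

end Construction

namespace HallMHD

/-- The half-open cube `(-L, L]³`. -/
def cube (L : ℝ) : Set E3 := {x | ∀ i, x i ∈ Set.Ioc (-L) L}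

/-- The function takes equal values at opposite points of the faces of the cube. -/
def FaceEq {F : Type*} (L : ℝ) (f : E3 → F) : Prop :=
  ∀ (i : Fin 3) (x : E3), x i = -L → f (x + EuclideanSpace.single i (2 * L)) = f x

theorem measurableSet_cube (L : ℝ) : MeasurableSet (cube L) := by
  have : cube L = ⋂ i, (fun x : E3 => x i) ⁻¹' Set.Ioc (-L) L := by
    ext x; simp [cube]
  rw [this]
  exact MeasurableSet.iInter fun i => measurableSet_Ioc.preimage (by fun_prop)

theorem isBounded_cube (L : ℝ) : Bornology.IsBounded (cube L) := by
  refine ((isCompact_Icc (a := fun _ : Fin 3 => -L) (b := fun _ => L)).image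
    (PiLp.continuous_toLp 2 _)).isBounded.subset fun x hx => ⟨WithLp.ofLp x, ?_, rfl⟩
  exact ⟨fun i => (hx i).1.le, fun i => (hx i).2⟩

theorem Continuous.integrableOn_of_isBounded {F : Type*} [NormedAddCommGroup F] {f : E3 → F}
    (hf : Continuous f) {s : Set E3} (hs : Bornology.IsBounded s) :
    IntegrableOn f s :=
  (hf.continuousOn.integrableOn_compact hs.isCompact_closure).mono_set subset_closure

theorem integral_cube_eq {F : Type*} [NormedAddCommGroup F] [NormedSpace ℝ F] (L : ℝ)
    (f : E3 → F) :
    ∫ x in cube L, f x = ∫ y in Set.Icc (fun _ : Fin 3 => -L) (fun _ => L), f (WithLp.toLp 2 y) := by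
  rw [← (PiLp.volume_preserving_toLp (Fin 3)).setIntegral_preimage_emb
    (MeasurableEquiv.toLp 2 (Fin 3 → ℝ)).measurableEmbedding]
  refine setIntegral_congr_set ?_
  have : WithLp.toLp 2 ⁻¹' cube L = Set.pi Set.univ fun _ : Fin 3 => Set.Ioc (-L) L := by
    ext y; simp [cube]
  rw [this]
  exact Measure.univ_pi_Ioc_ae_eq_Icc

theorem toLp_insertNth_add (i : Fin 3) (y : Fin 2 → ℝ) (a b : ℝ) :
    WithLp.toLp 2 (i.insertNth (a + b) y : Fin 3 → ℝ) =
      WithLp.toLp 2 (i.insertNth a y : Fin 3 → ℝ) + EuclideanSpace.single i b := by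
  ext j
  refine i.succAboveCases ?_ (fun k => ?_) j
  · simp
  · simp [Fin.succAbove_ne]

theorem integral_cube_fderiv_single {L : ℝ} (hL : 0 ≤ L) {f : E3 → ℝ} (hf : ContDiff ℝ 1 f)
    (hface : FaceEq L f) (i : Fin 3) :
    ∫ x in cube L, fderiv ℝ f x (EuclideanSpace.single i 1) = 0 := by
  rw [integral_cube_eq]
  let e : (Fin 3 → ℝ) →L[ℝ] E3 := (EuclideanSpace.equiv (Fin 3) ℝ).symm.toContinuousLinearMap
  have he : ∀ y, e y = WithLp.toLp 2 y := fun y => rfl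
  let g : Fin 3 → (Fin 3 → ℝ) → ℝ := fun j y => if j = i then f (e y) else 0
  let g' : Fin 3 → (Fin 3 → ℝ) → (Fin 3 → ℝ) →L[ℝ] ℝ := fun j y =>
    if j = i then (fderiv ℝ f (e y)).comp e else 0
  have hsum : ∀ y, ∑ j, g' j y (Pi.single j 1) =
      fderiv ℝ f (WithLp.toLp 2 y) (EuclideanSpace.single i 1) := fun y => by
    rw [Finset.sum_eq_single i]
    · simp only [g', if_true, ContinuousLinearMap.comp_apply, he]
      rfl
    · intro j _ hj; simp [g', hj]
    · simp
  have hcont : Continuous fun y : Fin 3 → ℝ =>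
      fderiv ℝ f (WithLp.toLp 2 y) (EuclideanSpace.single i 1) :=
    ((hf.continuous_fderiv one_ne_zero).comp e.continuous).clm_apply continuous_const
  have key := integral_divergence_of_hasFDerivAt_off_countable' (n := 2) (E := ℝ)
    (fun _ => -L) (fun _ => L) (fun _ => by simp; linarith) g g' ∅ Set.countable_empty
    (fun j => by
      by_cases hj : j = i
      · simp only [g, hj, if_true]; exact (hf.continuous.comp e.continuous).continuousOn
      · simp only [g, hj, if_false]; exact continuousOn_const)
    (fun x _ j => by
      by_cases hj : j = i
      · simp only [g, g', hj, if_true]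
        exact ((hf.differentiable one_ne_zero) (e x)).hasFDerivAt.comp x e.hasFDerivAt
      · simp only [g, g', hj, if_false]; exact hasFDerivAt_const _ _)
    (by
      simp_rw [hsum]
      exact hcont.continuousOn.integrableOn_compact isCompact_Icc)
  simp_rw [hsum] at key
  rw [key]
  refine Finset.sum_eq_zero fun j _ => ?_
  by_cases hj : j = i
  · subst hj
    rw [sub_eq_zero]
    refine integral_congr_ae (Eventually.of_forall fun y => ?_)
    simp only [g, if_true, he]
    have := toLp_insertNth_add j y (-L) (2 * L)
    rw [show -L + 2 * L = L by ring] at this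
    rw [this]
    exact hface j _ (by simp)
  · simp [g, hj]

theorem partialD_eq_fderiv {F : E3 → E3} {x : E3} (hF : DifferentiableAt ℝ F x) (i j : Fin 3) :
    partialD F i j x = fderiv ℝ (fun y => F y j) x (EuclideanSpace.single i 1) := by
  have h : HasFDerivAt (fun y => F y j)
      ((EuclideanSpace.proj j : E3 →L[ℝ] ℝ).comp (fderiv ℝ F x)) x :=
    (EuclideanSpace.proj j : E3 →L[ℝ] ℝ).hasFDerivAt.comp x hF.hasFDerivAt
  rw [h.fderiv]
  rfl

theorem continuous_partialD {F : E3 → E3} (hF : ContDiff ℝ 1 F) (i j : Fin 3) :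
    Continuous (partialD F i j) := by
  have h : Continuous fun x => fderiv ℝ F x (EuclideanSpace.single i 1) :=
    (hF.continuous_fderiv one_ne_zero).clm_apply continuous_const
  exact (EuclideanSpace.proj j : E3 →L[ℝ] ℝ).continuous.comp h

theorem continuous_curl {F : E3 → E3} (hF : ContDiff ℝ 1 F) : Continuous (curl F) := by
  have h := continuous_partialD hF
  refine (PiLp.continuous_toLp 2 _).comp (continuous_pi fun i => ?_)
  fin_cases i
  · exact (h 1 2).sub (h 2 1)
  · exact (h 2 0).sub (h 0 2)
  · exact (h 0 1).sub (h 1 0)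

theorem contDiff_apply {F : E3 → E3} {n : WithTop ℕ∞} (hF : ContDiff ℝ n F) (j : Fin 3) :
    ContDiff ℝ n fun x => F x j :=
  (EuclideanSpace.proj j : E3 →L[ℝ] ℝ).contDiff.comp hF

theorem integrableOn_cube_mul_partialD (L : ℝ) {F G : E3 → E3} (hF : ContDiff ℝ 1 F)
    (hG : ContDiff ℝ 1 G) (i j k : Fin 3) :
    IntegrableOn (fun x => F x j * partialD G i k x) (cube L) :=
  Continuous.integrableOn_of_isBounded
    ((contDiff_apply hF j).continuous.mul (continuous_partialD hG i k)) (isBounded_cube L)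

/-- Integration by parts on the cube. -/
theorem integral_cube_mul_partialD {L : ℝ} (hL : 0 ≤ L) {F G : E3 → E3} (hF : ContDiff ℝ 1 F)
    (hG : ContDiff ℝ 1 G) (hFL : FaceEq L F) (hGL : FaceEq L G) (i j k : Fin 3) :
    ∫ x in cube L, (F x j * partialD G i k x + G x k * partialD F i j x) = 0 := by
  have hFj := contDiff_apply hF j
  have hGk := contDiff_apply hG k
  rw [← integral_cube_fderiv_single hL (hFj.mul hGk)
    (fun m x hx => by simp only [hFL m x hx, hGL m x hx]) i]
  refine integral_congr_ae (Eventually.of_forall fun x => ?_)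
  simp only
  rw [fderiv_fun_mul (hFj.differentiable one_ne_zero x) (hGk.differentiable one_ne_zero x),
    partialD_eq_fderiv (hF.differentiable one_ne_zero x),
    partialD_eq_fderiv (hG.differentiable one_ne_zero x)]
  simp

theorem integral_cube_curl {L : ℝ} (hL : 0 ≤ L) {F G : E3 → E3} (hF : ContDiff ℝ 1 F)
    (hG : ContDiff ℝ 1 G) (hFL : FaceEq L F) (hGL : FaceEq L G) :
    ∫ x in cube L, inner ℝ (curl F x) (G x) = ∫ x in cube L, inner ℝ (F x) (curl G x) := by
  let d : Fin 3 → Fin 3 → Fin 3 → E3 → ℝ := fun i j k x =>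
    F x j * partialD G i k x + G x k * partialD F i j x
  have hd : ∀ i j k, ∫ x in cube L, d i j k x = 0 := integral_cube_mul_partialD hL hF hG hFL hGL
  have hint : ∀ i j k, IntegrableOn (d i j k) (cube L) := fun i j k =>
    (integrableOn_cube_mul_partialD L hF hG i j k).add
      (integrableOn_cube_mul_partialD L hG hF i k j)
  have hint' : IntegrableOn (fun x => inner ℝ (F x) (curl G x)) (cube L) :=
    Continuous.integrableOn_of_isBounded (hF.continuous.inner (continuous_curl hG))
      (isBounded_cube L)
  have hEq : ∀ x, inner ℝ (curl F x) (G x) = inner ℝ (F x) (curl G x) +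
      ((d 1 2 0 x - d 2 1 0 x) + (d 2 0 1 x - d 0 2 1 x) + (d 0 1 2 x - d 1 0 2 x)) := by
    intro x
    simp only [PiLp.inner_apply, Fin.sum_univ_three, curl, d, RCLike.inner_apply,
      RCLike.conj_to_real]
    simp
    ring
  simp_rw [hEq]
  have h1 := (hint 1 2 0).sub (hint 2 1 0)
  have h2 := (hint 2 0 1).sub (hint 0 2 1)
  have h3 := (hint 0 1 2).sub (hint 1 0 2)
  have h12 := h1.add h2
  have h123 := h12.add h3
  refine (integral_add hint' h123).trans ?_
  rw [integral_add' h12 h3, integral_add' h1 h2, integral_sub' (hint 1 2 0) (hint 2 1 0),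
    integral_sub' (hint 2 0 1) (hint 0 2 1), integral_sub' (hint 0 1 2) (hint 1 0 2)]
  simp [hd]

attribute [local instance] instMeasureSpaceUnitAddCircle

/-- The wave vector `(π / L) k` of a Fourier mode on the cube `(-L, L]³`. -/
def waveVec (L : ℝ) (k : Fin 3 → ℤ) : E3 := WithLp.toLp 2 fun i => Real.pi / L * k i

/-- Cosine coefficient of a function on the cube. -/
def cosCoeff {F : Type*} [NormedAddCommGroup F] [NormedSpace ℝ F] (L : ℝ) (f : E3 → F)
    (k : Fin 3 → ℤ) : F :=
  ∫ x in cube L, Real.cos (inner ℝ (waveVec L k) x) • f x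

/-- Sine coefficient of a function on the cube. -/
def sinCoeff {F : Type*} [NormedAddCommGroup F] [NormedSpace ℝ F] (L : ℝ) (f : E3 → F)
    (k : Fin 3 → ℤ) : F :=
  ∫ x in cube L, Real.sin (inner ℝ (waveVec L k) x) • f x

/-- The identification of the unit torus with the cube `(-L, L]³`. -/
def torusToCube (L : ℝ) (t : UnitAddTorus (Fin 3)) : E3 :=
  (2 * L) • WithLp.toLp 2 (UnitAddTorus.measurableEquivPiIoc (fun _ : Fin 3 => (-1 / 2 : ℝ)) t).1

theorem measurePreserving_torusToCube {L : ℝ} (hL : 0 < L) :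
    MeasurePreserving (torusToCube L) volume
      (ENNReal.ofReal (((2 * L) ^ 3)⁻¹) • volume.restrict (cube L)) := by
  set a : Fin 3 → ℝ := fun _ => -1 / 2 with ha
  set A : Set (Fin 3 → ℝ) := {x | ∀ i, x i ∈ Set.Ioc (a i) (a i + 1)} with hA
  have hAm : MeasurableSet A := MeasurableSet.univ_pi' fun i => measurableSet_Ioc
  have h1 := UnitAddTorus.measurePreserving_equivPiIoc a
  have h2 : MeasurePreserving ((↑) : A → Fin 3 → ℝ) (Measure.comap Subtype.val volume)
      (volume.restrict A) := measurePreserving_subtype_coe hAm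
  have h3 : MeasurePreserving (WithLp.toLp 2 : (Fin 3 → ℝ) → E3) (volume.restrict A)
      (volume.restrict (WithLp.ofLp ⁻¹' A)) := by
    have := (PiLp.volume_preserving_toLp (Fin 3)).restrict_preimage
      (s := (WithLp.ofLp ⁻¹' A : Set E3)) (hAm.preimage (PiLp.volume_preserving_ofLp _).measurable)
    simpa using! this
  have hr : (2 * L) ≠ 0 := by positivity
  have hpre : (fun x : E3 => (2 * L) • x) ⁻¹' cube L = WithLp.ofLp ⁻¹' A := by
    ext x
    simp only [cube, Set.mem_preimage, Set.mem_ofPred_eq, hA, ha, Set.mem_Ioc, PiLp.smul_apply,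
      smul_eq_mul]
    refine forall_congr' fun i => and_congr ⟨fun h => ?_, fun h => ?_⟩ ⟨fun h => ?_, fun h => ?_⟩ <;>
    nlinarith
  have h4 : MeasurePreserving (fun x : E3 => (2 * L) • x) (volume.restrict (WithLp.ofLp ⁻¹' A))
      (ENNReal.ofReal (((2 * L) ^ 3)⁻¹) • volume.restrict (cube L)) := by
    refine ⟨by fun_prop, ?_⟩
    rw [← hpre, ← Measure.restrict_map (by fun_prop) (measurableSet_cube L),
      Measure.map_addHaar_smul volume hr, Measure.restrict_smul]
    congr 2
    rw [finrank_euclideanSpace_fin, abs_of_pos (by positivity)]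
  exact h4.comp (h3.comp (h2.comp h1))

theorem integral_comp_torusToCube {F : Type*} [NormedAddCommGroup F] [NormedSpace ℝ F]
    {L : ℝ} (hL : 0 < L) {f : E3 → F} (hf : AEStronglyMeasurable f (volume.restrict (cube L))) :
    ∫ t, f (torusToCube L t) = ((2 * L) ^ 3)⁻¹ • ∫ x in cube L, f x := by
  have h := measurePreserving_torusToCube hL
  have h' := integral_map (f := f) h.measurable.aemeasurable
    (by rw [h.map_eq]; exact hf.smul_measure _)
  rw [← h', h.map_eq, integral_smul_measure, ENNReal.toReal_ofReal (by positivity)]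

theorem mFourier_neg_torusToCube {L : ℝ} (hL : 0 < L) (k : Fin 3 → ℤ)
    (t : UnitAddTorus (Fin 3)) :
    UnitAddTorus.mFourier (-k) t =
      Complex.exp (-(inner ℝ (waveVec L k) (torusToCube L t) : ℝ) * Complex.I) := by
  have ht : ∀ i, t i = (((UnitAddTorus.measurableEquivPiIoc (fun _ : Fin 3 => (-1 / 2 : ℝ)) t).1 i :
      ℝ) : UnitAddCircle) := fun i => by
    have := (UnitAddTorus.measurableEquivPiIoc (fun _ : Fin 3 => (-1 / 2 : ℝ))).symm_apply_apply t
    exact (congrFun this i).symm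
  have hprod : UnitAddTorus.mFourier (-k) t = ∏ i, fourier (-k i) (t i) := rfl
  rw [hprod]
  conv_lhs => enter [2, i]; rw [ht i, fourier_coe_apply]
  rw [← Complex.exp_sum]
  congr 1
  simp only [torusToCube, waveVec, PiLp.inner_apply, RCLike.inner_apply, RCLike.conj_to_real,
    PiLp.smul_apply, smul_eq_mul]
  push_cast
  rw [← Finset.sum_neg_distrib, Finset.sum_mul]
  refine Finset.sum_congr rfl fun i _ => ?_
  have : (L : ℂ) ≠ 0 := by exact_mod_cast hL.ne'
  field_simp

theorem integrableOn_cos_smul {F : Type*} [NormedAddCommGroup F] [NormedSpace ℝ F] {L : ℝ}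
    {f : E3 → F} (hf : IntegrableOn f (cube L)) (κ : E3) :
    IntegrableOn (fun x => Real.cos (inner ℝ κ x) • f x) (cube L) :=
  Integrable.bdd_smul hf 1 (by fun_prop) (Eventually.of_forall fun x => by
    simpa using Real.abs_cos_le_one _)

theorem integrableOn_sin_smul {F : Type*} [NormedAddCommGroup F] [NormedSpace ℝ F] {L : ℝ}
    {f : E3 → F} (hf : IntegrableOn f (cube L)) (κ : E3) :
    IntegrableOn (fun x => Real.sin (inner ℝ κ x) • f x) (cube L) :=
  Integrable.bdd_smul hf 1 (by fun_prop) (Eventually.of_forall fun x => by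
    simpa using Real.abs_sin_le_one _)

theorem isFiniteMeasure_restrict_cube (L : ℝ) : IsFiniteMeasure (volume.restrict (cube L)) :=
  ⟨by simpa using (isBounded_cube L).measure_lt_top⟩

theorem mFourierCoeff_comp_torusToCube {L : ℝ} (hL : 0 < L) {f : E3 → ℝ}
    (hf : IntegrableOn f (cube L)) (k : Fin 3 → ℤ) :
    UnitAddTorus.mFourierCoeff (fun t => ((f (torusToCube L t) : ℝ) : ℂ)) k =
      (((2 * L) ^ 3)⁻¹ : ℝ) * (cosCoeff L f k - sinCoeff L f k * Complex.I) := by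
  unfold UnitAddTorus.mFourierCoeff
  simp_rw [mFourier_neg_torusToCube hL, smul_eq_mul]
  rw [integral_comp_torusToCube hL (f := fun x =>
    Complex.exp (-(inner ℝ (waveVec L k) x : ℝ) * Complex.I) * (f x : ℂ))
    ((by fun_prop : Continuous fun x : E3 => Complex.exp
      (-(inner ℝ (waveVec L k) x : ℝ) * Complex.I)).aestronglyMeasurable.mul
      (Complex.continuous_ofReal.comp_aestronglyMeasurable hf.1)), Complex.real_smul]
  congr 1
  have h : ∀ x : E3, Complex.exp (-(inner ℝ (waveVec L k) x : ℝ) * Complex.I) * (f x : ℂ) =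
      ((Real.cos (inner ℝ (waveVec L k) x) • f x : ℝ) : ℂ) -
        ((Real.sin (inner ℝ (waveVec L k) x) • f x : ℝ) : ℂ) * Complex.I := fun x => by
    rw [Complex.exp_mul_I, Complex.cos_neg, Complex.sin_neg]
    push_cast [smul_eq_mul]
    ring
  simp_rw [h]
  rw [integral_sub (integrableOn_cos_smul hf _).ofReal
    ((integrableOn_sin_smul hf _).ofReal.mul_const _), integral_mul_const, integral_complex_ofReal,
    integral_complex_ofReal]
  rfl

/-- Parseval's identity on the cube. -/
theorem hasSum_coeff_mul {L : ℝ} (hL : 0 < L) {f g : E3 → ℝ}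
    (hf : MemLp f 2 (volume.restrict (cube L))) (hg : MemLp g 2 (volume.restrict (cube L))) :
    HasSum (fun k => cosCoeff L f k * cosCoeff L g k + sinCoeff L f k * sinCoeff L g k)
      ((2 * L) ^ 3 * ∫ x in cube L, f x * g x) := by
  have := isFiniteMeasure_restrict_cube L
  have hm := measurePreserving_torusToCube hL
  have lift : ∀ {f : E3 → ℝ}, MemLp f 2 (volume.restrict (cube L)) →
      MemLp (fun t => ((f (torusToCube L t) : ℝ) : ℂ)) 2 volume := fun {f} hf =>
    ((hf.smul_measure ENNReal.ofReal_ne_top).comp_measurePreserving hm).ofReal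
  have hP := UnitAddTorus.hasSum_prod_mFourierCoeff (MemLp.toLp _ (lift hf)) (MemLp.toLp _ (lift hg))
  have hc : ∀ {f : E3 → ℝ} (hf : MemLp f 2 (volume.restrict (cube L))) (k : Fin 3 → ℤ),
      UnitAddTorus.mFourierCoeff (MemLp.toLp _ (lift hf)) k =
        (((2 * L) ^ 3)⁻¹ : ℝ) * (cosCoeff L f k - sinCoeff L f k * Complex.I) := by
    intro f hf k
    rw [← mFourierCoeff_comp_torusToCube hL (hf.integrable one_le_two) k]
    refine integral_congr_ae ?_
    filter_upwards [(lift hf).coeFn_toLp] with t ht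
    rw [ht]
  have hI : ∫ t, starRingEnd ℂ (MemLp.toLp _ (lift hf) t) * MemLp.toLp _ (lift hg) t =
      ((((2 * L) ^ 3)⁻¹ * ∫ x in cube L, f x * g x : ℝ) : ℂ) := by
    have h1 : ∫ t, starRingEnd ℂ (MemLp.toLp _ (lift hf) t) * MemLp.toLp _ (lift hg) t =
        ∫ t, ((f (torusToCube L t) * g (torusToCube L t) : ℝ) : ℂ) := by
      refine integral_congr_ae ?_
      filter_upwards [(lift hf).coeFn_toLp, (lift hg).coeFn_toLp] with t ht ht'
      rw [ht, ht', Complex.conj_ofReal, Complex.ofReal_mul]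
    rw [h1, integral_complex_ofReal, integral_comp_torusToCube hL (f := fun x => f x * g x)
      (hf.1.mul hg.1), smul_eq_mul]
  rw [hI] at hP
  have hP₂ : HasSum (fun k => starRingEnd ℂ ((((2 * L) ^ 3)⁻¹ : ℝ) *
      (cosCoeff L f k - sinCoeff L f k * Complex.I)) * ((((2 * L) ^ 3)⁻¹ : ℝ) *
      (cosCoeff L g k - sinCoeff L g k * Complex.I)))
      ((((2 * L) ^ 3)⁻¹ * ∫ x in cube L, f x * g x : ℝ) : ℂ) :=
    HasSum.congr_fun hP fun k => by rw [← hc hf, ← hc hg]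
  have hP' := (Complex.hasSum_re hP₂).mul_left (((2 * L) ^ 3) ^ 2)
  have hL3 : (2 * L) ^ 3 ≠ 0 := by positivity
  have key : ∀ c a b a' b' : ℝ, (starRingEnd ℂ ((c : ℂ) * (a - b * Complex.I)) *
      (c * (a' - b' * Complex.I))).re = c ^ 2 * (a * a' + b * b') := fun c a b a' b' => by
    simp
    ring
  convert! hP' using 1
  · ext k
    rw [key]
    field_simp
  · rw [Complex.ofReal_re]
    field_simp

/-- The cross product on Euclidean three-space. -/
def cross (a b : E3) : E3 :=
  !₂[a 1 * b 2 - a 2 * b 1, a 2 * b 0 - a 0 * b 2, a 0 * b 1 - a 1 * b 0]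

theorem inner_E3 (a b : E3) : inner ℝ a b = a 0 * b 0 + a 1 * b 1 + a 2 * b 2 := by
  simp [PiLp.inner_apply, Fin.sum_univ_three, mul_comm]

theorem inner_cross (a b c : E3) : inner ℝ a (cross b c) = -inner ℝ c (cross b a) := by
  simp [inner_E3, cross]; ring

theorem norm_cross_le (a b : E3) : ‖cross a b‖ ≤ ‖a‖ * ‖b‖ := by
  refine le_of_sq_le_sq ?_ (by positivity)
  rw [mul_pow, ← real_inner_self_eq_norm_sq, ← real_inner_self_eq_norm_sq,
    ← real_inner_self_eq_norm_sq]
  simp only [inner_E3, cross]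
  simp
  nlinarith [sq_nonneg (a 0 * b 0 + a 1 * b 1 + a 2 * b 2)]

/-- A vector of the form `κ × s` pairs with `p` only through `κ × p`. -/
theorem norm_mul_abs_inner_cross_le (κ s p : E3) :
    ‖κ‖ * |inner ℝ (cross κ s) p| ≤ ‖cross κ s‖ * ‖cross κ p‖ := by
  rcases (norm_nonneg κ).eq_or_lt with h | h
  · rw [← h, zero_mul]; positivity
  have h1 : ‖κ‖ ^ 2 * inner ℝ (cross κ s) p = inner ℝ (cross κ (cross κ s)) (cross κ p) := by
    rw [← real_inner_self_eq_norm_sq]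
    simp only [inner_E3, cross]
    simp
    ring
  have h2 : ‖κ‖ ^ 2 * |inner ℝ (cross κ s) p| ≤ ‖κ‖ * ‖cross κ s‖ * ‖cross κ p‖ := by
    rw [← abs_of_nonneg (sq_nonneg ‖κ‖), ← abs_mul, h1]
    exact (abs_real_inner_le_norm _ _).trans (by gcongr; exact norm_cross_le _ _)
  rw [sq, mul_assoc, mul_assoc] at h2
  exact le_of_mul_le_mul_left h2 h

theorem partialD_comp_inner_smul {h : ℝ → ℝ} {h' : ℝ} (κ a x : E3)
    (hh : HasDerivAt h h' (inner ℝ κ x)) (i j : Fin 3) :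
    partialD (fun y => h (inner ℝ κ y) • a) i j x = h' * κ i * a j := by
  have h1 : HasFDerivAt (fun y : E3 => inner ℝ κ y) (innerSL ℝ κ) x := (innerSL ℝ κ).hasFDerivAt
  have h2 : HasFDerivAt (fun y => h (inner ℝ κ y) • a) ((h' • innerSL ℝ κ).smulRight a) x :=
    (hh.comp_hasFDerivAt x h1).smul_const a
  unfold partialD
  rw [h2.fderiv]
  simp [inner_E3, mul_assoc]
  fin_cases i <;> simp

theorem curl_comp_inner_smul {h : ℝ → ℝ} {h' : ℝ} (κ a x : E3)
    (hh : HasDerivAt h h' (inner ℝ κ x)) :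
    curl (fun y => h (inner ℝ κ y) • a) x = h' • cross κ a := by
  ext i
  fin_cases i <;> simp [curl, partialD_comp_inner_smul κ a x hh, cross] <;> ring

/-- The field `cos (κ · x) a`. -/
def cosField (L : ℝ) (k : Fin 3 → ℤ) (a x : E3) : E3 := Real.cos (inner ℝ (waveVec L k) x) • a

/-- The field `sin (κ · x) a`. -/
def sinField (L : ℝ) (k : Fin 3 → ℤ) (a x : E3) : E3 := Real.sin (inner ℝ (waveVec L k) x) • a

theorem contDiff_cosField (L : ℝ) (k : Fin 3 → ℤ) (a : E3) {n : WithTop ℕ∞} :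
    ContDiff ℝ n (cosField L k a) := 
  (Real.contDiff_cos.comp (innerSL ℝ (waveVec L k)).contDiff).smul contDiff_const

theorem contDiff_sinField (L : ℝ) (k : Fin 3 → ℤ) (a : E3) {n : WithTop ℕ∞} :
    ContDiff ℝ n (sinField L k a) := 
  (Real.contDiff_sin.comp (innerSL ℝ (waveVec L k)).contDiff).smul contDiff_const

theorem inner_waveVec_add_single {L : ℝ} (hL : 0 < L) (k : Fin 3 → ℤ) (x : E3) (i : Fin 3) :
    inner ℝ (waveVec L k) (x + EuclideanSpace.single i (2 * L)) =
      inner ℝ (waveVec L k) x + k i * (2 * Real.pi) := by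
  rw [inner_add_right, EuclideanSpace.inner_single_right]
  simp only [waveVec, RCLike.conj_to_real]
  field_simp

theorem cosField_add_single {L : ℝ} (hL : 0 < L) (k : Fin 3 → ℤ) (a x : E3) (i : Fin 3) :
    cosField L k a (x + EuclideanSpace.single i (2 * L)) = cosField L k a x := by
  rw [cosField, inner_waveVec_add_single hL, Real.cos_add_int_mul_two_pi, cosField]

theorem sinField_add_single {L : ℝ} (hL : 0 < L) (k : Fin 3 → ℤ) (a x : E3) (i : Fin 3) :
    sinField L k a (x + EuclideanSpace.single i (2 * L)) = sinField L k a x := by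
  rw [sinField, inner_waveVec_add_single hL, Real.sin_add_int_mul_two_pi, sinField]

theorem integral_inner_cosField {L : ℝ} {F : E3 → E3} (hF : IntegrableOn F (cube L))
    (k : Fin 3 → ℤ) (a : E3) :
    ∫ x in cube L, inner ℝ (F x) (cosField L k a x) = inner ℝ a (cosCoeff L F k) := by
  rw [cosCoeff, ← integral_inner (integrableOn_cos_smul hF _)]
  simp only [cosField, inner_smul_right, real_inner_comm a]

theorem integral_inner_sinField {L : ℝ} {F : E3 → E3} (hF : IntegrableOn F (cube L))
    (k : Fin 3 → ℤ) (a : E3) :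
    ∫ x in cube L, inner ℝ (F x) (sinField L k a x) = inner ℝ a (sinCoeff L F k) := by
  rw [sinCoeff, ← integral_inner (integrableOn_sin_smul hF _)]
  simp only [sinField, inner_smul_right, real_inner_comm a]

theorem curl_cosField (L : ℝ) (k : Fin 3 → ℤ) (a x : E3) :
    curl (cosField L k a) x = -sinField L k (cross (waveVec L k) a) x := by
  rw [sinField, ← neg_smul]
  exact curl_comp_inner_smul _ _ _ (Real.hasDerivAt_cos _)

theorem curl_sinField (L : ℝ) (k : Fin 3 → ℤ) (a x : E3) :
    curl (sinField L k a) x = cosField L k (cross (waveVec L k) a) x :=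
  curl_comp_inner_smul _ _ _ (Real.hasDerivAt_sin _)

theorem cosCoeff_eq_cross {L : ℝ} {F G : E3 → E3} (hF : IntegrableOn F (cube L))
    (hG : IntegrableOn G (cube L)) {k : Fin 3 → ℤ}
    (h : ∀ a, ∫ x in cube L, inner ℝ (F x) (curl (cosField L k a) x) =
      ∫ x in cube L, inner ℝ (G x) (cosField L k a x)) :
    cosCoeff L G k = cross (waveVec L k) (sinCoeff L F k) := by
  refine ext_inner_left ℝ fun a => ?_
  rw [← integral_inner_cosField hG, ← h a, inner_cross]
  simp_rw [curl_cosField, inner_neg_right]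
  rw [integral_neg, integral_inner_sinField hF, real_inner_comm]

theorem sinCoeff_eq_cross {L : ℝ} {F G : E3 → E3} (hF : IntegrableOn F (cube L))
    (hG : IntegrableOn G (cube L)) {k : Fin 3 → ℤ}
    (h : ∀ a, ∫ x in cube L, inner ℝ (F x) (curl (sinField L k a) x) =
      ∫ x in cube L, inner ℝ (G x) (sinField L k a x)) :
    sinCoeff L G k = -cross (waveVec L k) (cosCoeff L F k) := by
  refine ext_inner_left ℝ fun a => ?_
  rw [← integral_inner_sinField hG, ← h a, inner_neg_right, inner_cross, neg_neg]
  simp_rw [curl_sinField]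
  rw [integral_inner_cosField hF, real_inner_comm]

theorem cosCoeff_apply {L : ℝ} {F : E3 → E3} (hF : IntegrableOn F (cube L)) (k : Fin 3 → ℤ)
    (j : Fin 3) : cosCoeff L F k j = cosCoeff L (fun x => F x j) k :=
  ((EuclideanSpace.proj j : E3 →L[ℝ] ℝ).integral_comp_comm (integrableOn_cos_smul hF _)).symm

theorem sinCoeff_apply {L : ℝ} {F : E3 → E3} (hF : IntegrableOn F (cube L)) (k : Fin 3 → ℤ)
    (j : Fin 3) : sinCoeff L F k j = sinCoeff L (fun x => F x j) k :=
  ((EuclideanSpace.proj j : E3 →L[ℝ] ℝ).integral_comp_comm (integrableOn_sin_smul hF _)).symm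

theorem MemLp.integrableOn_cube {L : ℝ} {F : E3 → E3} (hF : MemLp F 2 (volume.restrict (cube L))) :
    IntegrableOn F (cube L) :=
  have := isFiniteMeasure_restrict_cube L
  hF.integrable one_le_two

/-- Parseval's identity for vector fields on the cube. -/
theorem hasSum_inner_coeff {L : ℝ} (hL : 0 < L) {F G : E3 → E3}
    (hF : MemLp F 2 (volume.restrict (cube L))) (hG : MemLp G 2 (volume.restrict (cube L))) :
    HasSum (fun k => inner ℝ (cosCoeff L F k) (cosCoeff L G k) +
      inner ℝ (sinCoeff L F k) (sinCoeff L G k))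
      ((2 * L) ^ 3 * ∫ x in cube L, inner ℝ (F x) (G x)) := by
  have hFi := MemLp.integrableOn_cube hF
  have hGi := MemLp.integrableOn_cube hG
  have hFj : ∀ j, MemLp (fun x => F x j) 2 (volume.restrict (cube L)) := fun j =>
    (EuclideanSpace.proj j : E3 →L[ℝ] ℝ).comp_memLp' hF
  have hGj : ∀ j, MemLp (fun x => G x j) 2 (volume.restrict (cube L)) := fun j =>
    (EuclideanSpace.proj j : E3 →L[ℝ] ℝ).comp_memLp' hG
  have h := hasSum_sum (s := Finset.univ) fun j _ => hasSum_coeff_mul hL (hFj j) (hGj j)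
  convert! h using 1
  · ext k
    simp only [PiLp.inner_apply, RCLike.inner_apply, RCLike.conj_to_real, cosCoeff_apply hFi,
      cosCoeff_apply hGi, sinCoeff_apply hFi, sinCoeff_apply hGi, ← Finset.sum_add_distrib]
    refine Finset.sum_congr rfl fun j _ => ?_
    ring
  · rw [← Finset.mul_sum, ← integral_finsetSum (f := fun j x => F x j * G x j) _
      fun j _ => (hFj j).integrable_mul (hGj j)]
    simp only [PiLp.inner_apply, RCLike.inner_apply, RCLike.conj_to_real, mul_comm]

theorem finite_norm_waveVec_lt {L : ℝ} (hL : 0 < L) (R : ℝ) :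
    {k : Fin 3 → ℤ | ‖waveVec L k‖ < R}.Finite := by
  have hπ := Real.pi_pos
  let M : ℤ := ⌈R * L / Real.pi⌉
  refine (Set.finite_Icc (fun _ : Fin 3 => -M) (fun _ => M)).subset fun k hk => ?_
  have h : ∀ i, |k i| ≤ M := by
    intro i
    have h1 : |Real.pi / L * k i| ≤ ‖waveVec L k‖ :=
      PiLp.norm_apply_le (waveVec L k) i
    have h2 : Real.pi / L * |(k i : ℝ)| < R := by
      rw [abs_mul, abs_of_pos (by positivity)] at h1
      exact h1.trans_lt hk
    have h3 : |(k i : ℝ)| ≤ R * L / Real.pi := by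
      rw [le_div_iff₀ hπ]
      rw [div_mul_eq_mul_div, div_lt_iff₀ hL] at h2
      linarith
    have h4 := h3.trans (Int.le_ceil _)
    exact_mod_cast h4
  exact ⟨fun i => (abs_le.1 (h i)).1, fun i => (abs_le.1 (h i)).2⟩

theorem le_norm_waveVec {L : ℝ} (hL : 0 < L) {k : Fin 3 → ℤ} (hk : k ≠ 0) :
    Real.pi / L ≤ ‖waveVec L k‖ := by
  have hπ := Real.pi_pos
  obtain ⟨i, hi⟩ := Function.ne_iff.1 hk
  have h1 : |Real.pi / L * k i| ≤ ‖waveVec L k‖ :=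
    PiLp.norm_apply_le (waveVec L k) i
  have h2 : (1 : ℝ) ≤ |(k i : ℝ)| := by exact_mod_cast Int.one_le_abs hi
  rw [abs_mul, abs_of_pos (by positivity : 0 < Real.pi / L)] at h1
  exact (le_mul_of_one_le_right (by positivity) h2).trans h1

theorem hasSum_sq_coeff {L : ℝ} (hL : 0 < L) {F : E3 → E3}
    (hF : MemLp F 2 (volume.restrict (cube L))) :
    HasSum (fun k => ‖cosCoeff L F k‖ ^ 2 + ‖sinCoeff L F k‖ ^ 2)
      ((2 * L) ^ 3 * ∫ x in cube L, ‖F x‖ ^ 2) := by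
  simpa only [real_inner_self_eq_norm_sq] using hasSum_inner_coeff hL hF hF

theorem Continuous.memLp_of_isBounded {F : E3 → E3} (hF : Continuous F) {s : Set E3}
    (hs : Bornology.IsBounded s) : MemLp F 2 (volume.restrict s) := by
  rw [memLp_two_iff_integrable_sq_norm hF.aestronglyMeasurable]
  exact Continuous.integrableOn_of_isBounded (by fun_prop) hs

theorem coeff_curl {L : ℝ} (hL : 0 < L) {F : E3 → E3} (hF : ContDiff ℝ 1 F) (hFL : FaceEq L F)
    (k : Fin 3 → ℤ) :
    cosCoeff L (curl F) k = cross (waveVec L k) (sinCoeff L F k) ∧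
      sinCoeff L (curl F) k = -cross (waveVec L k) (cosCoeff L F k) := by
  have h1 := Continuous.integrableOn_of_isBounded hF.continuous (isBounded_cube L)
  have h2 := Continuous.integrableOn_of_isBounded (continuous_curl hF) (isBounded_cube L)
  exact ⟨cosCoeff_eq_cross h1 h2 fun a => (integral_cube_curl hL.le hF
      (contDiff_cosField L k a) hFL fun i x _ => cosField_add_single hL k a x i).symm,
    sinCoeff_eq_cross h1 h2 fun a => (integral_cube_curl hL.le hF
      (contDiff_sinField L k a) hFL fun i x _ => sinField_add_single hL k a x i).symm⟩

theorem abs_inner_coeff_le {κ c s c' s' : E3} {B C D E : E3} (hB : B = cross κ s)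
    (hC : C = -cross κ c) (hD : D = cross κ s') (hE : E = -cross κ c') :
    ‖κ‖ * |inner ℝ B c' + inner ℝ C s'| ≤
      √(‖B‖ ^ 2 + ‖C‖ ^ 2) * √(‖D‖ ^ 2 + ‖E‖ ^ 2) := by
  have h1 := norm_mul_abs_inner_cross_le κ s c'
  have h2 := norm_mul_abs_inner_cross_le κ c s'
  have e1 : ‖cross κ c'‖ = ‖E‖ := by rw [hE, norm_neg]
  have e2 : ‖cross κ c‖ = ‖C‖ := by rw [hC, norm_neg]
  have e3 : |inner ℝ C s'| = |inner ℝ (cross κ c) s'| := by rw [hC, inner_neg_left, abs_neg]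
  rw [← hB, e1] at h1
  rw [← e3, ← hD, e2] at h2
  have h3 : ‖B‖ * ‖E‖ + ‖C‖ * ‖D‖ ≤ √(‖B‖ ^ 2 + ‖C‖ ^ 2) * √(‖D‖ ^ 2 + ‖E‖ ^ 2) := by
    rw [← Real.sqrt_mul (by positivity)]
    refine Real.le_sqrt_of_sq_le ?_
    nlinarith [sq_nonneg (‖B‖ * ‖D‖ - ‖C‖ * ‖E‖)]
  calc ‖κ‖ * |inner ℝ B c' + inner ℝ C s'| ≤ ‖κ‖ * (|inner ℝ B c'| + |inner ℝ C s'|) := by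
        gcongr; exact abs_add_le _ _
    _ ≤ _ := by rw [mul_add]; linarith

/-- The key estimate: up to finitely many Fourier coefficients, `∇ × ψ ↦ ψ` is small. -/
theorem abs_integral_inner_curl_le {L : ℝ} (hL : 0 < L) {ε : ℝ} (hε : 0 < ε) :
    ∃ (s : Finset (Fin 3 → ℤ)) (C : ℝ), 0 ≤ C ∧ ∀ ψ φ : E3 → E3, ContDiff ℝ 1 ψ → ContDiff ℝ 1 φ →
      FaceEq L ψ → FaceEq L φ → |∫ x in cube L, inner ℝ (curl ψ x) (φ x)| ≤
        (ε * √(∫ x in cube L, ‖curl ψ x‖ ^ 2) +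
          C * ∑ k ∈ s, (‖cosCoeff L (curl ψ) k‖ + ‖sinCoeff L (curl ψ) k‖)) *
            √(∫ x in cube L, ‖curl φ x‖ ^ 2) := by
  have hπ := Real.pi_pos
  set V : ℝ := (2 * L) ^ 3 with hV
  have hV0 : 0 < V := by positivity
  refine ⟨(finite_norm_waveVec_lt hL ε⁻¹).toFinset, L / Real.pi * √V / V, by positivity, ?_⟩
  set s := (finite_norm_waveVec_lt hL ε⁻¹).toFinset
  intro ψ φ hψ hφ hψL hφL
  have mem : ∀ {F : E3 → E3}, Continuous F → MemLp F 2 (volume.restrict (cube L)) :=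
    fun hF => Continuous.memLp_of_isBounded hF (isBounded_cube L)
  have hsum := hasSum_inner_coeff hL (mem (continuous_curl hψ)) (mem hφ.continuous)
  have hsumB := hasSum_sq_coeff hL (mem (continuous_curl hψ))
  have hsumB' := hasSum_sq_coeff hL (mem (continuous_curl hφ))
  set I := ∫ x in cube L, inner ℝ (curl ψ x) (φ x)
  set J := ∫ x in cube L, ‖curl ψ x‖ ^ 2
  set J' := ∫ x in cube L, ‖curl φ x‖ ^ 2
  have hJ : 0 ≤ J := integral_nonneg fun x => sq_nonneg _
  have hJ' : 0 ≤ J' := integral_nonneg fun x => sq_nonneg _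
  set N : (Fin 3 → ℤ) → ℝ := fun k => √(‖cosCoeff L (curl ψ) k‖ ^ 2 + ‖sinCoeff L (curl ψ) k‖ ^ 2)
  set N' : (Fin 3 → ℤ) → ℝ := fun k =>
    √(‖cosCoeff L (curl φ) k‖ ^ 2 + ‖sinCoeff L (curl φ) k‖ ^ 2)
  have hN : ∀ k, 0 ≤ N k := fun k => Real.sqrt_nonneg _
  have hN' : ∀ k, 0 ≤ N' k := fun k => Real.sqrt_nonneg _
  have hNsq : ∀ k, N' k ^ 2 = ‖cosCoeff L (curl φ) k‖ ^ 2 + ‖sinCoeff L (curl φ) k‖ ^ 2 :=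
    fun k => Real.sq_sqrt (by positivity)
  obtain ⟨T, -, hT, hsumT⟩ := Real.inner_le_Lp_mul_Lq_hasSum_of_nonneg Real.HolderConjugate.two_two
    (Real.sqrt_nonneg (V * J)) (Real.sqrt_nonneg (V * J')) hN hN'
    (by simp_rw [Real.rpow_two, Real.sq_sqrt (mul_nonneg hV0.le hJ)]
        refine hsumB.congr_fun fun k => ?_
        exact Real.sq_sqrt (by positivity))
    (by simp_rw [Real.rpow_two, Real.sq_sqrt (mul_nonneg hV0.le hJ')]
        refine hsumB'.congr_fun fun k => ?_
        exact hNsq k)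
  have hN'le : ∀ k, N' k ≤ √V * √J' := fun k => by
    rw [← Real.sqrt_mul hV0.le]
    refine Real.sqrt_le_sqrt ?_
    exact le_hasSum hsumB' k fun j _ => by positivity
  have hterm : ∀ k, ‖inner ℝ (cosCoeff L (curl ψ) k) (cosCoeff L φ k) +
      inner ℝ (sinCoeff L (curl ψ) k) (sinCoeff L φ k)‖ ≤
      ε * (N k * N' k) + if k ∈ s then L / Real.pi * (N k * N' k) else 0 := by
    intro k
    obtain ⟨h1, h2⟩ := coeff_curl hL hψ hψL k
    obtain ⟨h3, h4⟩ := coeff_curl hL hφ hφL k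
    have h5 := abs_inner_coeff_le h1 h2 h3 h4
    have hNN : 0 ≤ N k * N' k := mul_nonneg (hN k) (hN' k)
    rw [Real.norm_eq_abs]
    split_ifs with hk
    · by_cases h0 : k = 0
      · have hw : waveVec L k = 0 := by ext i; simp [waveVec, h0]
        have hc : ∀ a, cross 0 a = 0 := fun a => by ext i; fin_cases i <;> simp [cross]
        rw [h1, h2, hw, hc, hc]
        simp only [neg_zero, inner_zero_left, add_zero, abs_zero]
        positivity
      · have h6 := le_norm_waveVec hL h0
        have h7 := (mul_le_mul_of_nonneg_right h6 (abs_nonneg _)).trans h5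
        rw [div_mul_eq_mul_div, div_le_iff₀ hL] at h7
        have : |inner ℝ (cosCoeff L (curl ψ) k) (cosCoeff L φ k) +
            inner ℝ (sinCoeff L (curl ψ) k) (sinCoeff L φ k)| ≤ L / Real.pi * (N k * N' k) := by
          rw [div_mul_eq_mul_div, le_div_iff₀ hπ]
          linarith
        have := mul_nonneg hε.le hNN
        linarith
    · have h6 : ε⁻¹ ≤ ‖waveVec L k‖ := by simpa [s] using hk
      have h7 := (mul_le_mul_of_nonneg_right h6 (abs_nonneg _)).trans h5
      rw [inv_mul_le_iff₀ hε] at h7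
      linarith
  have hsum2 : HasSum (fun k => ε * (N k * N' k) + if k ∈ s then L / Real.pi * (N k * N' k) else 0)
      (ε * T + ∑ k ∈ s, L / Real.pi * (N k * N' k)) := by
    refine (hsumT.mul_left ε).add ?_
    have := hasSum_sum_of_ne_finset_zero (L := SummationFilter.unconditional _)
      (f := fun k => if k ∈ s then L / Real.pi * (N k * N' k) else 0) (s := s)
      fun k hk => by simp [hk]
    rwa [Finset.sum_congr rfl fun k hk => if_pos hk] at this
  have hfin := hsum.norm_le_of_bounded hsum2 hterm
  rw [Real.norm_eq_abs, abs_mul, abs_of_pos hV0] at hfin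
  have h8 : ∑ k ∈ s, L / Real.pi * (N k * N' k) ≤ L / Real.pi * (√V * √J') *
      ∑ k ∈ s, (‖cosCoeff L (curl ψ) k‖ + ‖sinCoeff L (curl ψ) k‖) := by
    rw [Finset.mul_sum]
    refine Finset.sum_le_sum fun k _ => ?_
    have h9 : N k ≤ ‖cosCoeff L (curl ψ) k‖ + ‖sinCoeff L (curl ψ) k‖ := by
      refine Real.sqrt_le_iff.2 ⟨by positivity, ?_⟩
      have := mul_nonneg (norm_nonneg (cosCoeff L (curl ψ) k)) (norm_nonneg (sinCoeff L (curl ψ) k))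
      nlinarith
    calc L / Real.pi * (N k * N' k) ≤ L / Real.pi * ((‖cosCoeff L (curl ψ) k‖ +
          ‖sinCoeff L (curl ψ) k‖) * (√V * √J')) := by
          gcongr
          exact hN'le k
      _ = _ := by ring
  have hT' : T ≤ V * (√J * √J') := by
    rw [Real.sqrt_mul hV0.le, Real.sqrt_mul hV0.le] at hT
    refine hT.trans (le_of_eq ?_)
    have := Real.mul_self_sqrt hV0.le
    calc √V * √J * (√V * √J') = (√V * √V) * (√J * √J') := by ring
      _ = _ := by rw [this]
  have h10 : V * |I| ≤ V * ((ε * √J + L / Real.pi * √V / V *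
      ∑ k ∈ s, (‖cosCoeff L (curl ψ) k‖ + ‖sinCoeff L (curl ψ) k‖)) * √J') := by
    have h11 := mul_le_mul_of_nonneg_left hT' hε.le
    refine (hfin.trans (add_le_add h11 h8)).trans (le_of_eq ?_)
    field_simp
  exact le_of_mul_le_mul_left h10 hV0

theorem partialD_add {F G : E3 → E3} (hF : Differentiable ℝ F) (hG : Differentiable ℝ G)
    (i j : Fin 3) : partialD (F + G) i j = partialD F i j + partialD G i j := by
  ext x
  simp [partialD, fderiv_add (hF x) (hG x)]

theorem partialD_smul {F : E3 → E3} (c : ℝ) (hF : Differentiable ℝ F) (i j : Fin 3) :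
    partialD (c • F) i j = c • partialD F i j := by
  ext x
  simp [partialD, fderiv_const_smul (hF x)]

theorem curl_add {F G : E3 → E3} (hF : Differentiable ℝ F) (hG : Differentiable ℝ G) :
    curl (F + G) = curl F + curl G := by
  ext x i
  fin_cases i <;> simp [curl, partialD_add hF hG] <;> ring

theorem curl_smul {F : E3 → E3} (c : ℝ) (hF : Differentiable ℝ F) :
    curl (c • F) = c • curl F := by
  ext x i
  fin_cases i <;> simp [curl, partialD_smul c hF] <;> ring

namespace Dom

variable {D : Dom}

theorem IsTest.contDiff {φ : E3 → E3} (h : D.IsTest φ) : ContDiff ℝ (⊤ : ℕ∞) φ := by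
  cases D with
  | torus => exact h.1
  | bounded => exact h.1

theorem IsTest.contDiff_one {φ : E3 → E3} (h : D.IsTest φ) : ContDiff ℝ 1 φ :=
  h.contDiff.of_le (by exact_mod_cast le_top)

theorem IsTest.differentiable {φ : E3 → E3} (h : D.IsTest φ) : Differentiable ℝ φ :=
  h.contDiff_one.differentiable one_ne_zero

theorem IsTest.add {φ ψ : E3 → E3} (hφ : D.IsTest φ) (hψ : D.IsTest ψ) : D.IsTest (φ + ψ) := by
  cases D with
  | torus => exact ⟨hφ.1.add hψ.1, fun i x => by simp [hφ.2 i x, hψ.2 i x]⟩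
  | bounded =>
    exact ⟨hφ.1.add hψ.1, hφ.2.1.add hψ.2.1,
      (tsupport_add φ ψ).trans (Set.union_subset hφ.2.2 hψ.2.2)⟩

theorem IsTest.clm {φ : E3 → E3} (hφ : D.IsTest φ) (A : E3 →L[ℝ] E3) :
    D.IsTest fun x => A (φ x) := by
  cases D with
  | torus => exact ⟨A.contDiff.comp hφ.1, fun i x => by simp [hφ.2 i x]⟩
  | bounded =>
    exact ⟨A.contDiff.comp hφ.1, hφ.2.1.comp_left (map_zero A),
      (closure_mono fun x (hx : A (φ x) ≠ 0) (h : φ x = 0) => hx (by rw [h, map_zero])).trans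
        hφ.2.2⟩

theorem IsTest.fderiv {φ : E3 → E3} (hφ : D.IsTest φ) (i : Fin 3) :
    D.IsTest fun x => fderiv ℝ φ x (EuclideanSpace.single i 1) := by
  have hc : ContDiff ℝ (⊤ : ℕ∞) fun x => _root_.fderiv ℝ φ x (EuclideanSpace.single i 1) :=
    (hφ.contDiff.fderiv_right (m := (⊤ : ℕ∞)) le_rfl).clm_apply contDiff_const
  cases D with
  | torus =>
    refine ⟨hc, fun j x => ?_⟩
    have h := fderiv_comp_add_right (𝕜 := ℝ) (f := φ) (x := x)
      (EuclideanSpace.single j (2 * Real.pi))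
    rw [funext (hφ.2 j)] at h
    simp only [h]
  | bounded =>
    exact ⟨hc, hφ.2.1.fderiv_apply ℝ _, (tsupport_fderiv_apply_subset ℝ _).trans hφ.2.2⟩

variable (D) in
/-- The space of test fields. -/
def testSpace : Submodule ℝ (E3 → E3) where
  carrier := {φ | D.IsTest φ}
  add_mem' := IsTest.add
  zero_mem' := by
    cases D with
    | torus => exact ⟨contDiff_const, fun _ _ => rfl⟩
    | bounded => exact ⟨contDiff_const, HasCompactSupport.zero, by simp [tsupport]⟩
  smul_mem' c φ hφ := hφ.clm (c • ContinuousLinearMap.id ℝ E3)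

theorem IsTest.apply_smul {φ : E3 → E3} (hφ : D.IsTest φ) (j : Fin 3) (a : E3) :
    D.IsTest fun x => φ x j • a :=
  hφ.clm ((EuclideanSpace.proj j : E3 →L[ℝ] ℝ).smulRight a)

theorem IsTest.partialD_smul {φ : E3 → E3} (hφ : D.IsTest φ) (i j : Fin 3) (a : E3) :
    D.IsTest fun x => partialD φ i j x • a :=
  (hφ.fderiv i).apply_smul j a

theorem IsTest.curl {φ : E3 → E3} (hφ : D.IsTest φ) : D.IsTest (curl φ) := by
  let e : Fin 3 → E3 := fun i => EuclideanSpace.single i 1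
  let p : Fin 3 → Fin 3 → Fin 3 → D.testSpace := fun i j k => ⟨_, hφ.partialD_smul i j (e k)⟩
  have h := ((p 1 2 0 - p 2 1 0) + (p 2 0 1 - p 0 2 1) + (p 0 1 2 - p 1 0 2)).2
  convert! h using 1
  ext x i
  fin_cases i <;> simp [p, e, HallMHD.curl]

theorem exists_cube (D : Dom) : ∃ L : ℝ, 0 < L ∧ D.carrier ⊆ cube L ∧ ∀ φ, D.IsTest φ →
    FaceEq L φ ∧ ∀ x ∈ cube L \ D.carrier, φ x = 0 := by
  cases D with
  | torus =>
    exact ⟨Real.pi, Real.pi_pos, subset_rfl, fun φ hφ => ⟨fun i x _ => hφ.2 i x,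
      fun x hx => absurd hx.1 hx.2⟩⟩
  | bounded Ω ho hb hne =>
    obtain ⟨R, hR⟩ := hb.subset_ball 0
    have hlt : ∀ x ∈ Ω, ∀ i, |x i| < |R| + 1 := fun x hx i => by
      have h1 := PiLp.norm_apply_le x i
      have h2 := mem_ball_zero_iff.1 (hR hx)
      rw [Real.norm_eq_abs] at h1
      linarith [le_abs_self R]
    have hzero : ∀ φ, (bounded Ω ho hb hne).IsTest φ → ∀ x ∉ Ω, φ x = 0 := fun φ hφ x hx =>
      image_eq_zero_of_notMem_tsupport fun h => hx (hφ.2.2 h)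
    refine ⟨|R| + 1, by positivity, fun x hx i => ?_, fun φ hφ => ⟨fun i x hx => ?_,
      fun x hx => hzero φ hφ x hx.2⟩⟩
    · have := abs_lt.1 (hlt x hx i)
      exact ⟨this.1, this.2.le⟩
    · have hL : 0 ≤ |R| + 1 := by positivity
      rw [hzero φ hφ x fun h => ?_, hzero φ hφ (x + _) fun h => ?_]
      · have := hlt _ h i
        have e : (x + EuclideanSpace.single i (2 * (|R| + 1))) i = |R| + 1 := by
          simp [hx]; ring
        rw [e, abs_of_nonneg hL] at this
        exact lt_irrefl _ this
      · have := hlt x h i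
        rw [hx, abs_neg, abs_of_nonneg hL] at this
        exact lt_irrefl _ this

theorem isBounded_carrier (D : Dom) : Bornology.IsBounded D.carrier := by
  cases D with
  | torus => exact isBounded_cube _
  | bounded Ω _ hb _ => exact hb

theorem setIntegral_cube_eq {L : ℝ} (hL : D.carrier ⊆ cube L) {f : E3 → ℝ}
    (hf : ∀ x ∈ cube L \ D.carrier, f x = 0) : ∫ x in cube L, f x = ∫ x, f x ∂D.measure :=
  setIntegral_eq_of_subset_of_forall_sdiff_eq_zero (measurableSet_cube L) hL hf

theorem memLp_of_continuous {F : E3 → E3} (hF : Continuous F) : MemLp F 2 D.measure :=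
  Continuous.memLp_of_isBounded hF D.isBounded_carrier

theorem inner_toLp {F G : E3 → E3} (hF : MemLp F 2 D.measure) (hG : MemLp G 2 D.measure) :
    inner ℝ (hF.toLp F) (hG.toLp G) = ∫ x, inner ℝ (F x) (G x) ∂D.measure := by
  rw [L2.inner_def]
  refine integral_congr_ae ?_
  filter_upwards [hF.coeFn_toLp, hG.coeFn_toLp] with x h1 h2
  rw [h1, h2]

theorem norm_toLp_sq {F : E3 → E3} (hF : MemLp F 2 D.measure) :
    ‖hF.toLp F‖ ^ 2 = ∫ x, ‖F x‖ ^ 2 ∂D.measure := by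
  rw [← real_inner_self_eq_norm_sq, inner_toLp]
  simp only [real_inner_self_eq_norm_sq]

theorem memLp_test (φ : D.testSpace) : MemLp φ.1 2 D.measure :=
  memLp_of_continuous φ.2.contDiff.continuous

variable (D) in
/-- The embedding of test fields into `L²`. -/
def testToLp : D.testSpace →ₗ[ℝ] Lp E3 2 D.measure where
  toFun φ := (memLp_test φ).toLp φ.1
  map_add' _ _ := rfl
  map_smul' _ _ := rfl

variable (D) in
/-- The curl as an operator from test fields to test fields. -/
def curlTest : D.testSpace →ₗ[ℝ] D.testSpace where
  toFun φ := ⟨curl φ.1, φ.2.curl⟩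
  map_add' φ ψ := Subtype.ext (curl_add φ.2.differentiable ψ.2.differentiable)
  map_smul' c φ := Subtype.ext (curl_smul c φ.2.differentiable)

variable (D) in
/-- The curl as an operator from test fields to `L²`. -/
def curlToLp : D.testSpace →ₗ[ℝ] Lp E3 2 D.measure := D.testToLp ∘ₗ D.curlTest

variable (D) in
/-- The closure in `L²` of the curls of test fields. -/
abbrev curlSpace : Submodule ℝ (Lp E3 2 D.measure) :=
  (LinearMap.range D.curlToLp).topologicalClosure

theorem inner_toLp_testToLp {F : E3 → E3} (hF : MemLp F 2 D.measure) (φ : D.testSpace) :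
    inner ℝ (hF.toLp F) (D.testToLp φ) = ∫ x, inner ℝ (F x) (φ.1 x) ∂D.measure :=
  inner_toLp hF (memLp_test φ)

theorem inner_toLp_curlToLp {F : E3 → E3} (hF : MemLp F 2 D.measure) (φ : D.testSpace) :
    inner ℝ (hF.toLp F) (D.curlToLp φ) = ∫ x, inner ℝ (F x) (curl φ.1 x) ∂D.measure :=
  inner_toLp hF (memLp_test (D.curlTest φ))

theorem inner_curlToLp_testToLp (ψ φ : D.testSpace) :
    inner ℝ (D.curlToLp ψ) (D.testToLp φ) = ∫ x, inner ℝ (curl ψ.1 x) (φ.1 x) ∂D.measure :=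
  inner_toLp (memLp_test (D.curlTest ψ)) (memLp_test φ)

theorem inner_testToLp_curlToLp (ψ φ : D.testSpace) :
    inner ℝ (D.testToLp ψ) (D.curlToLp φ) = ∫ x, inner ℝ (ψ.1 x) (curl φ.1 x) ∂D.measure :=
  inner_toLp (memLp_test ψ) (memLp_test (D.curlTest φ))

theorem inner_curlToLp_comm (ψ φ : D.testSpace) :
    inner ℝ (D.curlToLp ψ) (D.testToLp φ) = inner ℝ (D.testToLp ψ) (D.curlToLp φ) := by
  obtain ⟨L, hL, hsub, htest⟩ := D.exists_cube
  rw [inner_curlToLp_testToLp, inner_testToLp_curlToLp,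
    ← setIntegral_cube_eq hsub, ← setIntegral_cube_eq hsub]
  · exact integral_cube_curl hL.le ψ.2.contDiff_one φ.2.contDiff_one (htest _ ψ.2).1 (htest _ φ.2).1
  · intro x hx
    rw [(htest _ ψ.2).2 x hx, inner_zero_left]
  · intro x hx
    rw [(htest _ φ.2).2 x hx, inner_zero_right]

theorem norm_le_sum_abs (a : E3) : ‖a‖ ≤ ∑ j, |a j| := by
  have h : a = ∑ j, EuclideanSpace.single j (a j) := by
    ext i; fin_cases i <;> simp [Fin.sum_univ_three]
  calc ‖a‖ = ‖∑ j, EuclideanSpace.single j (a j)‖ := by rw [← h]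
    _ ≤ ∑ j, ‖EuclideanSpace.single j (a j)‖ := norm_sum_le _ _
    _ = _ := by simp

theorem curlToLp_estimate (D : Dom) (ε : ℝ) (hε : 0 < ε) :
    ∃ (ι : Type) (s : Finset ι) (v : ι → Lp E3 2 D.measure), ∀ ψ φ,
      |inner ℝ (D.curlToLp ψ) (D.testToLp φ)| ≤
        (ε * ‖D.curlToLp ψ‖ + ∑ i ∈ s, |inner ℝ (v i) (D.curlToLp ψ)|) * ‖D.curlToLp φ‖ := by
  obtain ⟨L, hL, hsub, htest⟩ := D.exists_cube
  obtain ⟨s, C, hC, hest⟩ := abs_integral_inner_curl_le hL hε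
  let e : Fin 3 → E3 := fun i => EuclideanSpace.single i 1
  let v : ((Fin 3 → ℤ) × Fin 3) ⊕ ((Fin 3 → ℤ) × Fin 3) → Lp E3 2 D.measure := Sum.elim
    (fun i => C • (memLp_of_continuous (contDiff_cosField L i.1 (e i.2)
      (n := 0)).continuous).toLp _)
    (fun i => C • (memLp_of_continuous (contDiff_sinField L i.1 (e i.2)
      (n := 0)).continuous).toLp _)
  refine ⟨_, (s ×ˢ Finset.univ).disjSum (s ×ˢ Finset.univ), v, fun ψ φ => ?_⟩
  have hcurl0 : ∀ φ : D.testSpace, ∀ x ∈ cube L \ D.carrier, curl φ.1 x = 0 := fun φ =>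
    (htest _ φ.2.curl).2
  have hnorm : ∀ φ : D.testSpace, √(∫ x in cube L, ‖curl φ.1 x‖ ^ 2) = ‖D.curlToLp φ‖ := by
    intro φ
    rw [setIntegral_cube_eq hsub fun x hx => by rw [hcurl0 φ x hx]; simp,
      ← norm_toLp_sq (memLp_of_continuous φ.2.curl.contDiff.continuous)]
    exact Real.sqrt_sq (norm_nonneg _)
  have hint := Continuous.integrableOn_of_isBounded ψ.2.curl.contDiff.continuous (isBounded_cube L)
  have hcos : ∀ i, inner ℝ (v (Sum.inl i)) (D.curlToLp ψ) =
      C * cosCoeff L (curl ψ.1) i.1 i.2 := by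
    intro i
    simp only [v, Sum.elim_inl]
    rw [inner_smul_left, inner_toLp_curlToLp, ← setIntegral_cube_eq hsub fun x hx => by
      rw [hcurl0 ψ x hx, inner_zero_right]]
    simp_rw [real_inner_comm]
    rw [integral_inner_cosField hint, EuclideanSpace.inner_single_left]
    simp
  have hsin : ∀ i, inner ℝ (v (Sum.inr i)) (D.curlToLp ψ) =
      C * sinCoeff L (curl ψ.1) i.1 i.2 := by
    intro i
    simp only [v, Sum.elim_inr]
    rw [inner_smul_left, inner_toLp_curlToLp, ← setIntegral_cube_eq hsub fun x hx => by
      rw [hcurl0 ψ x hx, inner_zero_right]]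
    simp_rw [real_inner_comm]
    rw [integral_inner_sinField hint, EuclideanSpace.inner_single_left]
    simp
  have h := hest ψ.1 φ.1 ψ.2.contDiff_one φ.2.contDiff_one (htest _ ψ.2).1 (htest _ φ.2).1
  rw [hnorm, hnorm, setIntegral_cube_eq hsub fun x hx => by rw [hcurl0 ψ x hx, inner_zero_left],
    ← inner_curlToLp_testToLp] at h
  refine h.trans ?_
  gcongr
  rw [Finset.sum_disjSum, Finset.sum_product, Finset.sum_product, ← Finset.sum_add_distrib,
    Finset.mul_sum]
  refine Finset.sum_le_sum fun k _ => ?_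
  simp only [hcos, hsin, abs_mul, abs_of_nonneg hC, ← Finset.mul_sum, ← mul_add]
  gcongr
  · exact norm_le_sum_abs _
  · exact norm_le_sum_abs _

variable (D) in
/-- The field `(f, σ ∂₃f, 0)`, where `f` is the first component of `F`. Its helicity density has
the sign of `σ` on average. -/
def helix (σ : ℝ) : D.testSpace →ₗ[ℝ] D.testSpace where
  toFun F := ⟨fun x => F.1 x 0 • EuclideanSpace.single 0 1 +
      partialD F.1 2 0 x • EuclideanSpace.single 1 σ,
    D.testSpace.add_mem (F.2.apply_smul 0 (EuclideanSpace.single 0 1))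
      (F.2.partialD_smul 2 0 (EuclideanSpace.single 1 σ))⟩
  map_add' F G := by
    ext x i
    fin_cases i <;> simp [partialD_add F.2.differentiable G.2.differentiable, add_mul]
  map_smul' c F := by
    ext x i
    fin_cases i <;> simp [partialD_smul c F.2.differentiable, mul_assoc]

theorem inner_curlToLp_helix (σ : ℝ) (F : D.testSpace) :
    inner ℝ (D.curlToLp (D.helix σ F)) (D.testToLp (D.helix σ F)) =
      2 * σ * ∫ x, partialD F.1 2 0 x ^ 2 ∂D.measure := by
  obtain ⟨L, hL, hsub, htest⟩ := D.exists_cube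
  set ψ := D.helix σ F with hψ
  have h0 : ∀ x, ψ.1 x 0 = F.1 x 0 := fun x => by simp [hψ, helix]
  have h1 : ∀ x, ψ.1 x 1 = σ * partialD F.1 2 0 x := fun x => by simp [hψ, helix, mul_comm]
  have h2 : ∀ x, ψ.1 x 2 = 0 := fun x => by simp [hψ, helix]
  have hd2 : ∀ i x, partialD ψ.1 i 2 x = 0 := fun i x => by
    rw [partialD_eq_fderiv (ψ.2.differentiable x), funext h2]
    simp
  have hd0 : ∀ x, partialD ψ.1 2 0 x = partialD F.1 2 0 x := fun x => by
    rw [partialD_eq_fderiv (ψ.2.differentiable x), funext h0,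
      partialD_eq_fderiv (F.2.differentiable x)]
  have hψL := htest _ ψ.2
  have hparts := integral_cube_mul_partialD hL.le ψ.2.contDiff_one ψ.2.contDiff_one hψL.1 hψL.1 2 0 1
  rw [integral_add (integrableOn_cube_mul_partialD L ψ.2.contDiff_one ψ.2.contDiff_one 2 0 1)
    (integrableOn_cube_mul_partialD L ψ.2.contDiff_one ψ.2.contDiff_one 2 1 0)] at hparts
  have hinner : ∀ x, inner ℝ (curl ψ.1 x) (ψ.1 x) =
      ψ.1 x 1 * partialD ψ.1 2 0 x - ψ.1 x 0 * partialD ψ.1 2 1 x := fun x => by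
    rw [inner_E3]
    simp [curl, hd2, h2]
    ring
  have hsq : ∀ x, ψ.1 x 1 * partialD ψ.1 2 0 x = σ * partialD F.1 2 0 x ^ 2 := fun x => by
    rw [h1, hd0]; ring
  rw [inner_curlToLp_testToLp, ← setIntegral_cube_eq hsub fun x hx => by
    rw [hψL.2 x hx, inner_zero_right]]
  simp_rw [hinner]
  rw [integral_sub (integrableOn_cube_mul_partialD L ψ.2.contDiff_one ψ.2.contDiff_one 2 1 0)
    (integrableOn_cube_mul_partialD L ψ.2.contDiff_one ψ.2.contDiff_one 2 0 1),
    eq_neg_of_add_eq_zero_left hparts]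
  simp_rw [hsq]
  rw [integral_const_mul, setIntegral_cube_eq hsub fun x hx => ?_]
  · ring
  · have := (htest _ (F.2.partialD_smul 2 0 (EuclideanSpace.single 0 1))).2 x hx
    have h3 := congrArg (fun v : E3 => v 0) this
    simp only [PiLp.smul_apply, PiLp.single_apply, if_true, smul_eq_mul, mul_one,
      PiLp.zero_apply] at h3
    rw [h3]; ring

theorem integral_partialD_sq_pos {F : E3 → E3} (hF : ContDiff ℝ 1 F) {x : E3}
    (hx : x ∈ interior D.carrier) (h : partialD F 2 0 x ≠ 0) :
    0 < ∫ x, partialD F 2 0 x ^ 2 ∂D.measure := by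
  have hc := continuous_partialD hF 2 0
  rw [Dom.measure, setIntegral_pos_iff_support_of_nonneg_ae
    (Eventually.of_forall fun x => sq_nonneg _)
    (Continuous.integrableOn_of_isBounded (by fun_prop) D.isBounded_carrier)]
  have hopen : IsOpen ({y | partialD F 2 0 y ≠ 0} ∩ interior D.carrier) :=
    (isOpen_ne_fun hc continuous_const).inter isOpen_interior
  refine (hopen.measure_pos volume ⟨x, h, hx⟩).trans_le (measure_mono ?_)
  rintro y ⟨hy, hy'⟩
  exact ⟨by simpa using hy, interior_subset hy'⟩

theorem exists_partialD_ne_zero_of_hasCompactSupport {F : E3 → E3} (hF : ContDiff ℝ 1 F)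
    (hc : HasCompactSupport F) {p : E3} (hp : F p 0 ≠ 0) : ∃ x, partialD F 2 0 x ≠ 0 := by
  by_contra! h
  let e : E3 := EuclideanSpace.single 2 1
  have hderiv : ∀ t : ℝ, HasDerivAt (fun t : ℝ => F (p + t • e) 0) 0 t := by
    intro t
    have h1 : HasDerivAt (fun t : ℝ => p + t • e) e t := by
      simpa using ((hasDerivAt_id t).smul_const e).const_add p
    have h2 : HasFDerivAt (fun y => F y 0)
        ((EuclideanSpace.proj 0 : E3 →L[ℝ] ℝ).comp (fderiv ℝ F (p + t • e))) (p + t • e) :=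
      (EuclideanSpace.proj 0 : E3 →L[ℝ] ℝ).hasFDerivAt.comp _
        (hF.differentiable one_ne_zero _).hasFDerivAt
    have h3 := h2.comp_hasDerivAt t h1
    convert! h3 using 1
    exact (h (p + t • e)).symm
  have hconst : ∀ t : ℝ, F (p + t • e) 0 = F p 0 := fun t => by
    have := is_const_of_deriv_eq_zero (fun t => (hderiv t).differentiableAt)
      (fun t => (hderiv t).deriv) t 0
    simpa using this
  obtain ⟨R, hR⟩ := hc.isBounded.subset_ball p
  have h1 : p + (|R| + 1) • e ∉ tsupport F := fun hmem => by
    have := hR hmem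
    rw [mem_ball_iff_norm, add_sub_cancel_left, norm_smul] at this
    simp only [e, PiLp.norm_single, norm_one, mul_one, Real.norm_eq_abs] at this
    rw [abs_of_nonneg (by positivity)] at this
    linarith [le_abs_self R]
  have := hconst (|R| + 1)
  rw [image_eq_zero_of_notMem_tsupport h1] at this
  exact hp this.symm

theorem isTest_bump {Ω : Set E3} {ho : IsOpen Ω} {hb : Bornology.IsBounded Ω} {hne : Ω.Nonempty}
    {p : E3} (f : ContDiffBump p) (hf : Metric.closedBall p f.rOut ⊆ Ω) :
    (bounded Ω ho hb hne).IsTest fun x => f x • EuclideanSpace.single 0 1 := by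
  refine ⟨f.contDiff.smul contDiff_const, f.hasCompactSupport.smul_right, ?_⟩
  exact (tsupport_smul_subset_left _ _).trans (by rw [f.tsupport_eq]; exact hf)

theorem exists_independent_tests (D : Dom) : ∃ F G : D.testSpace, ∀ a b : ℝ, (a ≠ 0 ∨ b ≠ 0) →
    ∃ x ∈ interior D.carrier, partialD (a • F + b • G).1 2 0 x ≠ 0 := by
  cases D with
  | torus =>
    have hπ := Real.pi_pos
    have htest : ∀ n : ℤ, torus.IsTest
        (sinField Real.pi (Pi.single 2 n) (EuclideanSpace.single 0 1)) := fun n =>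
      ⟨contDiff_sinField _ _ _, fun i x => sinField_add_single hπ _ _ x i⟩
    have hpart : ∀ (n : ℤ) (x : E3),
        partialD (sinField Real.pi (Pi.single 2 n) (EuclideanSpace.single 0 1)) 2 0 x =
          Real.cos (n * x 2) * n := fun n x => by
      refine (partialD_comp_inner_smul _ _ x (Real.hasDerivAt_sin _) 2 0).trans ?_
      simp [waveVec, inner_E3, hπ.ne']
    have hmem : ∀ t : ℝ, 0 ≤ t → t < Real.pi → (EuclideanSpace.single 2 t : E3) ∈
        interior torus.carrier := by
      intro t ht ht'
      set U : Set E3 := {x | ∀ i, x i ∈ Set.Ioo (-Real.pi) Real.pi} with hU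
      have ho : IsOpen U := by
        simp only [hU, Set.ofPred_forall]
        exact isOpen_iInter_of_finite fun i => isOpen_Ioo.preimage (by fun_prop)
      have hsub : U ⊆ torus.carrier := fun x hx i => Set.Ioo_subset_Ioc_self (hx i)
      refine interior_maximal hsub ho fun i => ?_
      fin_cases i <;> (simp [hπ]; try constructor <;> linarith)
    refine ⟨⟨_, htest 1⟩, ⟨_, htest 2⟩, fun a b hab => ?_⟩
    have hval : ∀ x, partialD (a • (⟨_, htest 1⟩ : torus.testSpace) +
        b • (⟨_, htest 2⟩ : torus.testSpace)).1 2 0 x =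
        a * Real.cos (x 2) + b * (Real.cos (2 * x 2) * 2) := fun x => by
      have h1 := partialD_add ((htest 1).differentiable.const_smul a)
        ((htest 2).differentiable.const_smul b) 2 0
      rw [partialD_smul a (htest 1).differentiable, partialD_smul b (htest 2).differentiable] at h1
      refine (congrFun h1 x).trans ?_
      simp [hpart]
    by_contra! h
    have e0 := h _ (hmem 0 le_rfl hπ)
    have e1 := h _ (hmem (Real.pi / 2) (by positivity) (by linarith))
    rw [hval] at e0 e1
    have e2 : 2 * (Real.pi / 2) = Real.pi := by ring
    simp [e2] at e0 e1
    rcases hab with h | h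
    · rw [e1] at e0; exact h (by simpa using e0)
    · exact h e1
  | bounded Ω ho hb hne =>
    obtain ⟨p, hp⟩ := hne
    obtain ⟨r, hr, hball⟩ := Metric.isOpen_iff.1 ho p hp
    set q : E3 := p + EuclideanSpace.single 0 (r / 2) with hq
    have hpq : dist q p = r / 2 := by
      rw [dist_eq_norm, hq, add_sub_cancel_left, PiLp.norm_single, Real.norm_eq_abs,
        abs_of_pos (by positivity)]
    let f : ContDiffBump p := ⟨r / 8, r / 4, by positivity, by linarith⟩
    let g : ContDiffBump q := ⟨r / 8, r / 4, by positivity, by linarith⟩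
    have hf : (bounded Ω ho hb ⟨p, hp⟩).IsTest fun x => f x • EuclideanSpace.single 0 1 :=
      isTest_bump f ((Metric.closedBall_subset_ball (by change r / 4 < r; linarith)).trans hball)
    have hg : (bounded Ω ho hb ⟨p, hp⟩).IsTest fun x => g x • EuclideanSpace.single 0 1 := by
      refine isTest_bump g (Set.Subset.trans (fun x hx => ?_) hball)
      have h1 : dist x q ≤ r / 4 := hx
      have := dist_triangle x q p
      rw [Metric.mem_ball]
      linarith
    refine ⟨⟨_, hf⟩, ⟨_, hg⟩, fun a b hab => ?_⟩
    set F := (a • (⟨_, hf⟩ : (bounded Ω ho hb ⟨p, hp⟩).testSpace) + b • ⟨_, hg⟩) with hF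
    have hF0 : ∀ x, F.1 x 0 = a * f x + b * g x := fun x => by simp [hF]
    have hFne : ∃ y, F.1 y 0 ≠ 0 := by
      rcases hab with h | h
      · refine ⟨p, ?_⟩
        rw [hF0, f.one_of_mem_closedBall (Metric.mem_closedBall_self f.rIn_pos.le),
          g.zero_of_le_dist (by rw [dist_comm, hpq]; change r / 4 ≤ _; linarith)]
        simpa using h
      · refine ⟨q, ?_⟩
        rw [hF0, g.one_of_mem_closedBall (Metric.mem_closedBall_self g.rIn_pos.le),
          f.zero_of_le_dist (by rw [hpq]; change r / 4 ≤ _; linarith)]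
        simpa using h
    obtain ⟨y, hy⟩ := hFne
    have hFt : (bounded Ω ho hb ⟨p, hp⟩).IsTest F.1 := F.2
    obtain ⟨x, hx⟩ := exists_partialD_ne_zero_of_hasCompactSupport hFt.contDiff_one hFt.2.1 hy
    refine ⟨x, ?_, hx⟩
    rw [show (bounded Ω ho hb ⟨p, hp⟩).carrier = Ω from rfl, ho.interior_eq]
    refine hFt.2.2 (by_contra fun hmem => hx ?_)
    rw [partialD, fderiv_of_notMem_tsupport ℝ hmem]
    rfl

/-- The helicity takes both signs on every hyperplane. -/
theorem exists_helicity_sign (m : D.testSpace →ₗ[ℝ] ℝ) {σ : ℝ} (hσ : σ ≠ 0) :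
    ∃ φ, m φ = 0 ∧ 0 < σ * inner ℝ (D.curlToLp φ) (D.testToLp φ) := by
  obtain ⟨F, G, hFG⟩ := D.exists_independent_tests
  obtain ⟨a, b, hab, hm⟩ : ∃ a b : ℝ, (a ≠ 0 ∨ b ≠ 0) ∧
      a * m (D.helix σ F) + b * m (D.helix σ G) = 0 := by
    by_cases h : m (D.helix σ F) = 0
    · exact ⟨1, 0, Or.inl one_ne_zero, by simp [h]⟩
    · exact ⟨m (D.helix σ G), -m (D.helix σ F), Or.inr (neg_ne_zero.2 h), by ring⟩
  obtain ⟨x, hx, hx'⟩ := hFG a b hab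
  refine ⟨D.helix σ (a • F + b • G), by simpa using hm, ?_⟩
  rw [inner_curlToLp_helix]
  have := integral_partialD_sq_pos (a • F + b • G).2.contDiff_one hx hx'
  have h2 : 0 < σ ^ 2 := by positivity
  nlinarith [mul_pos h2 this]

theorem hasWeakCurl_iff {F G : E3 → E3} (hF : MemLp F 2 D.measure) (hG : MemLp G 2 D.measure) :
    D.HasWeakCurl F G ↔ ∀ φ : D.testSpace,
      inner ℝ (hF.toLp F) (D.curlToLp φ) = inner ℝ (hG.toLp G) (D.testToLp φ) := by
  simp only [inner_toLp_curlToLp, inner_toLp_testToLp]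
  exact ⟨fun h φ => h φ.1 φ.2, fun h φ hφ => h ⟨φ, hφ⟩⟩

/-- On the torus, an `L²` curl is orthogonal to all curl free fields. -/
theorem inner_toLp_eq_zero_of_torus {A B Z : E3 → E3} (hA : MemLp A 2 torus.measure)
    (hB : MemLp B 2 torus.measure) (hZ : MemLp Z 2 torus.measure) (hAB : torus.HasWeakCurl A B)
    (hZ0 : torus.HasWeakCurl Z 0) : inner ℝ (hZ.toLp Z) (hB.toLp B) = 0 := by
  have hπ := Real.pi_pos
  have hcos : ∀ k a, torus.IsTest (cosField Real.pi k a) := fun k a =>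
    ⟨contDiff_cosField _ _ _, fun i x => cosField_add_single hπ _ _ x i⟩
  have hsin : ∀ k a, torus.IsTest (sinField Real.pi k a) := fun k a =>
    ⟨contDiff_sinField _ _ _, fun i x => sinField_add_single hπ _ _ x i⟩
  have hAi := MemLp.integrableOn_cube (L := Real.pi) hA
  have hBi := MemLp.integrableOn_cube (L := Real.pi) hB
  have hZi := MemLp.integrableOn_cube (L := Real.pi) hZ
  have h0i : IntegrableOn (0 : E3 → E3) (cube Real.pi) := integrable_zero _ _ _
  have hz1 : ∀ k, cross (waveVec Real.pi k) (sinCoeff Real.pi Z k) = 0 := fun k => by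
    rw [← cosCoeff_eq_cross hZi h0i fun a => hZ0 _ (hcos k a)]
    simp [cosCoeff]
  have hz2 : ∀ k, cross (waveVec Real.pi k) (cosCoeff Real.pi Z k) = 0 := fun k => by
    rw [← neg_eq_zero, ← sinCoeff_eq_cross hZi h0i fun a => hZ0 _ (hsin k a)]
    simp [sinCoeff]
  have hsum := hasSum_inner_coeff hπ hZ hB
  have hterm : ∀ k, inner ℝ (cosCoeff Real.pi Z k) (cosCoeff Real.pi B k) +
      inner ℝ (sinCoeff Real.pi Z k) (sinCoeff Real.pi B k) = 0 := fun k => by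
    rw [cosCoeff_eq_cross hAi hBi fun a => hAB _ (hcos k a),
      sinCoeff_eq_cross hAi hBi fun a => hAB _ (hsin k a), inner_neg_right,
      inner_cross (cosCoeff Real.pi Z k), inner_cross (sinCoeff Real.pi Z k), hz1, hz2]
    simp
  simp_rw [hterm] at hsum
  have h := hsum.unique hasSum_zero
  rw [inner_toLp]
  exact (mul_eq_zero.1 h).resolve_left (by positivity)

theorem zeroBoundary_bounded_iff {Ω : Set E3} {ho : IsOpen Ω} {hb : Bornology.IsBounded Ω}
    {hne : Ω.Nonempty} {B : E3 → E3} (hB : MemLp B 2 (bounded Ω ho hb hne).measure) :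
    (bounded Ω ho hb hne).ZeroBoundary B ↔ hB.toLp B ∈ (bounded Ω ho hb hne).curlSpace := by
  set D := bounded Ω ho hb hne
  have hdist : ∀ φ : D.testSpace,
      dist (hB.toLp B) (D.curlToLp φ) ^ 2 = ∫ x, ‖B x - curl φ.1 x‖ ^ 2 ∂D.measure := fun φ => by
    rw [dist_eq_norm]
    exact norm_toLp_sq (hB.sub (memLp_test (D.curlTest φ)))
  rw [← SetLike.mem_coe, Submodule.topologicalClosure_coe, Metric.mem_closure_iff]
  constructor
  · intro h ε hε
    obtain ⟨φ, hφ, hlt⟩ := h (ε ^ 2) (by positivity)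
    refine ⟨_, ⟨⟨φ, hφ⟩, rfl⟩, ?_⟩
    rw [← hdist ⟨φ, hφ⟩] at hlt
    exact lt_of_pow_lt_pow_left₀ 2 hε.le hlt
  · intro h ε hε
    obtain ⟨_, ⟨φ, rfl⟩, hlt⟩ := h (√ε) (Real.sqrt_pos.2 hε)
    refine ⟨φ.1, φ.2, ?_⟩
    rw [← hdist, ← Real.sq_sqrt hε.le]
    exact pow_lt_pow_left₀ hlt dist_nonneg two_ne_zero

theorem toLp_mem_curlSpace {B : E3 → E3} (hB : B ∈ D.L2curl) :
    MemLp.toLp B hB.1 ∈ D.curlSpace := by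
  cases D with
  | torus =>
    obtain ⟨hB2, ⟨A, hA, hAB⟩, -⟩ := hB
    have hcl : curlSpace torus = (curlSpace torus)ᗮᗮ := by
      rw [Submodule.orthogonal_orthogonal]
    rw [hcl, Submodule.mem_orthogonal]
    intro z hz
    have hZ : MemLp z 2 torus.measure := Lp.memLp z
    have hzz : hZ.toLp z = z := Lp.toLp_coeFn z hZ
    rw [← hzz]
    refine inner_toLp_eq_zero_of_torus hA hB2 hZ hAB ?_
    rw [hasWeakCurl_iff hZ MemLp.zero]
    intro φ
    rw [hzz, real_inner_comm, MemLp.toLp_zero, inner_zero_left]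
    exact hz _ (Submodule.le_topologicalClosure _ ⟨φ, rfl⟩)
  | bounded Ω ho hb hne => exact (zeroBoundary_bounded_iff hB.1).1 hB.2.2

theorem mem_L2curl {A B : E3 → E3} (hB : MemLp B 2 D.measure) (hBX : hB.toLp B ∈ D.curlSpace)
    (hAB : D.IsPotential A B) : B ∈ D.L2curl := by
  refine ⟨hB, ⟨A, hAB⟩, ?_⟩
  cases D with
  | torus => trivial
  | bounded Ω ho hb hne => exact (zeroBoundary_bounded_iff hB).2 hBX

/-- The class of a field of `L²_curl` in the closure of the curls of test fields. -/
def toCurlSpace {B : E3 → E3} (hB : B ∈ D.L2curl) : D.curlSpace :=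
  ⟨MemLp.toLp B hB.1, toLp_mem_curlSpace hB⟩

theorem IsPotential.add {A B A' B' : E3 → E3} (h : D.IsPotential A B) (h' : D.IsPotential A' B')
    (hB : MemLp B 2 D.measure) (hB' : MemLp B' 2 D.measure) :
    D.IsPotential (A + A') (B + B') := by
  have hA : MemLp A 2 D.measure := h.1
  have hA' : MemLp A' 2 D.measure := h'.1
  refine ⟨hA.add hA', (hasWeakCurl_iff (hA.add hA') (hB.add hB')).2 fun φ => ?_⟩
  rw [MemLp.toLp_add hA hA', MemLp.toLp_add hB hB', inner_add_left, inner_add_left,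
    (hasWeakCurl_iff hA hB).1 h.2, (hasWeakCurl_iff hA' hB').1 h'.2]

theorem add_mem_L2curl {B B' : E3 → E3} (hB : B ∈ D.L2curl) (hB' : B' ∈ D.L2curl) :
    B + B' ∈ D.L2curl := by
  obtain ⟨A, hA⟩ := hB.2.1
  obtain ⟨A', hA'⟩ := hB'.2.1
  have h1 : MemLp B 2 D.measure := hB.1
  have h2 : MemLp B' 2 D.measure := hB'.1
  refine mem_L2curl (h1.add h2) ?_ (hA.add hA' h1 h2)
  rw [MemLp.toLp_add h1 h2]
  exact add_mem (toLp_mem_curlSpace hB) (toLp_mem_curlSpace hB')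

/-- `K` is a bounded inverse of the weak curl. -/
def IsInverseCurl (K : D.curlSpace →L[ℝ] D.curlSpace) : Prop :=
  ∀ x φ, inner ℝ (K x : Lp E3 2 D.measure) (D.curlToLp φ) =
    inner ℝ (x : Lp E3 2 D.measure) (D.testToLp φ)

variable {K : D.curlSpace →L[ℝ] D.curlSpace}

/-- The helicity does not depend on the vector potential. -/
theorem IsInverseCurl.helicity_eq (hK : IsInverseCurl K) {A B : E3 → E3} (hB : B ∈ D.L2curl)
    (hA : D.IsPotential A B) :
    D.helicity A B = inner ℝ (K (toCurlSpace hB)) (toCurlSpace hB) := by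
  have hA2 : MemLp A 2 D.measure := hA.1
  have h : ∀ z ∈ D.curlSpace, inner ℝ (hA2.toLp A) z =
      inner ℝ (K (toCurlSpace hB) : Lp E3 2 D.measure) z := by
    intro z hz
    refine closure_minimal (s := (LinearMap.range D.curlToLp : Set (Lp E3 2 D.measure)))
      (t := {z | inner ℝ (hA2.toLp A) z = inner ℝ (K (toCurlSpace hB) : Lp E3 2 D.measure) z})
      ?_ (isClosed_eq (by fun_prop) (by fun_prop)) hz
    rintro _ ⟨φ, rfl⟩
    exact ((hasWeakCurl_iff hA2 hB.1).1 hA.2 φ).trans (hK (toCurlSpace hB) φ).symm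
  rw [helicity, ← inner_toLp hA2 hB.1, h _ (toLp_mem_curlSpace hB)]
  rfl

theorem energy_eq {B : E3 → E3} (hB : B ∈ D.L2curl) : D.energy B = ‖toCurlSpace hB‖ ^ 2 :=
  (norm_toLp_sq hB.1).symm

theorem IsInverseCurl.mem_admissible_iff (hK : IsInverseCurl K) {u ω : E3 → E3}
    (hω : ω ∈ D.L2curl) (hu : D.IsPotential u ω) {h₁ h₂ : ℝ} {B : E3 → E3} (hB : B ∈ D.L2curl) :
    B ∈ D.admissible u ω h₁ h₂ ↔ inner ℝ (K (toCurlSpace hB)) (toCurlSpace hB) = h₁ ∧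
      inner ℝ (K (toCurlSpace hB + toCurlSpace hω)) (toCurlSpace hB + toCurlSpace hω) = h₂ := by
  have hadd : toCurlSpace (add_mem_L2curl hB hω) = toCurlSpace hB + toCurlSpace hω := rfl
  constructor
  · rintro ⟨-, A, hA, h1, h2⟩
    rw [hK.helicity_eq hB hA] at h1
    rw [hK.helicity_eq (add_mem_L2curl hB hω) (hA.add hu hB.1 hω.1), hadd] at h2
    exact ⟨h1, h2⟩
  · rintro ⟨h1, h2⟩
    obtain ⟨A, hA⟩ := hB.2.1
    refine ⟨hB, A, hA, ?_, ?_⟩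
    · rw [hK.helicity_eq hB hA, h1]
    · rw [hK.helicity_eq (add_mem_L2curl hB hω) (hA.add hu hB.1 hω.1), hadd, h2]

theorem IsInverseCurl.exists_toCurlSpace_eq (hK : IsInverseCurl K) (x : D.curlSpace) :
    ∃ (B : E3 → E3) (hB : B ∈ D.L2curl), toCurlSpace hB = x := by
  have hx : MemLp (x : Lp E3 2 D.measure) 2 D.measure := Lp.memLp _
  have hKx : MemLp (K x : Lp E3 2 D.measure) 2 D.measure := Lp.memLp _
  have e : hx.toLp _ = (x : Lp E3 2 D.measure) := Lp.toLp_coeFn _ hx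
  have e' : hKx.toLp _ = (K x : Lp E3 2 D.measure) := Lp.toLp_coeFn _ hKx
  refine ⟨_, mem_L2curl hx (by rw [e]; exact x.2) (A := (K x : Lp E3 2 D.measure))
    ⟨hKx, (hasWeakCurl_iff hKx hx).2 fun φ => ?_⟩, Subtype.ext e⟩
  rw [e, e']
  exact hK x φ

theorem IsInverseCurl.indefiniteOnHyperplanes (hK : IsInverseCurl K) :
    IndefiniteOnHyperplanes K := by
  intro m
  have hmem : ∀ φ, D.curlToLp φ ∈ D.curlSpace := fun φ =>
    Submodule.le_topologicalClosure _ ⟨φ, rfl⟩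
  let e : D.testSpace →ₗ[ℝ] D.curlSpace := D.curlToLp.codRestrict _ hmem
  have hq : ∀ φ, inner ℝ (K (e φ)) (e φ) = inner ℝ (D.curlToLp φ) (D.testToLp φ) := fun φ =>
    hK (e φ) φ
  let l : D.testSpace →ₗ[ℝ] ℝ := (innerSL ℝ m).toLinearMap ∘ₗ e
  obtain ⟨φ, hφ, hφ'⟩ := exists_helicity_sign l one_ne_zero
  obtain ⟨ψ, hψ, hψ'⟩ := exists_helicity_sign l (neg_ne_zero.2 one_ne_zero)
  refine ⟨⟨e φ, hφ, ?_⟩, ⟨e ψ, hψ, ?_⟩⟩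
  · rw [hq]; linarith
  · rw [hq]; linarith

end Dom

end HallMHD

theorem inner_combination_eq {H : Type*} [NormedAddCommGroup H] [InnerProductSpace ℝ H]
    {p q a b s t : H} (l₁ l₂ : ℝ) (h₁ : inner ℝ p s = inner ℝ a t)
    (h₂ : inner ℝ q s = inner ℝ b t) :
    inner ℝ (l₁ • p + l₂ • q) s = inner ℝ (l₁ • a + l₂ • b) t := by
  simp only [inner_add_left, inner_smul_left, h₁, h₂]

open HallMHD HallMHD.Dom in
theorem proposition2p2 (D : HallMHD.Dom) (u ω : HallMHD.E3 → HallMHD.E3)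
    (hω : ω ∈ D.L2curl) (hu : D.IsPotential u ω)
    (h₁ h₂ : ℝ) (hh₁ : h₁ ≠ 0) (hh₂ : h₂ ≠ 0) :
    ((¬ (ω =ᵐ[D.measure] 0) ∨ h₁ = h₂) → ∃ B, D.IsMinimizer u ω h₁ h₂ B) ∧
    ∀ B, D.IsMinimizer u ω h₁ h₂ B →
      ∃ l₁ l₂ : ℝ, D.HasWeakCurl B (l₁ • B + l₂ • (B + ω)) := by
  obtain ⟨K, hcomp, hsym, hinj, hK⟩ := exists_compact_inverse D.curlToLp D.testToLp
    inner_curlToLp_comm (fun φ => ⟨D.curlTest φ, rfl⟩) D.curlToLp_estimate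
  replace hK : IsInverseCurl K := hK
  have hind := hK.indefiniteOnHyperplanes
  set w := toCurlSpace hω with hw
  constructor
  · intro h
    have hne : w ≠ 0 ∨ h₁ = h₂ := by
      refine h.imp_left fun h0 hw0 => h0 ?_
      have : MemLp.toLp ω hω.1 = 0 := congrArg Subtype.val hw0
      exact (MemLp.coeFn_toLp hω.1).symm.trans ((Lp.eq_zero_iff_ae_eq_zero).1 this)
    obtain ⟨x, hx, hmin⟩ := hcomp.exists_min_norm w h₁ h₂
      (hind.exists_mem_levels hsym hinj w h₁ h₂ hne)
    obtain ⟨B, hB, rfl⟩ := hK.exists_toCurlSpace_eq x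
    refine ⟨B, (hK.mem_admissible_iff hω hu hB).2 hx, fun B' hB' => ?_⟩
    rw [energy_eq hB, energy_eq hB'.1]
    exact pow_le_pow_left₀ (norm_nonneg _)
      (hmin _ ((hK.mem_admissible_iff hω hu hB'.1).1 hB')) 2
  · rintro B ⟨hB, hmin⟩
    obtain ⟨hb1, hb2⟩ := (hK.mem_admissible_iff hω hu hB.1).1 hB
    set b := toCurlSpace hB.1 with hb
    obtain ⟨l₁, l₂, hl⟩ := hind.exists_multipliers hsym hinj w b hh₁ hh₂ hb1 hb2 fun y hy1 hy2 => by
      obtain ⟨B', hB', rfl⟩ := hK.exists_toCurlSpace_eq y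
      have := hmin B' ((hK.mem_admissible_iff hω hu hB').2 ⟨hy1, hy2⟩)
      rw [energy_eq hB.1, energy_eq hB'] at this
      exact le_of_sq_le_sq this (norm_nonneg _)
    refine ⟨l₁, l₂, ?_⟩
    have hB2 : MemLp B 2 D.measure := hB.1.1
    have hω2 : MemLp ω 2 D.measure := hω.1
    have hBω : MemLp (B + ω) 2 D.measure := hB2.add hω2
    have h1 : MemLp (l₁ • B) 2 D.measure := hB2.const_smul l₁
    have h2 : MemLp (l₂ • (B + ω)) 2 D.measure := hBω.const_smul l₂
    have hsum : (h1.add h2).toLp (l₁ • B + l₂ • (B + ω)) =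
        l₁ • (b : Lp E3 2 D.measure) + l₂ • ((b + w : D.curlSpace) : Lp E3 2 D.measure) :=
      rfl
    have hl' : hB2.toLp B = l₁ • (K b : Lp E3 2 D.measure) +
        l₂ • (K (b + w) : Lp E3 2 D.measure) := congrArg Subtype.val hl
    refine (hasWeakCurl_iff hB2 (h1.add h2)).2 fun φ => ?_
    have hcomb := inner_combination_eq l₁ l₂ (hK b φ) (hK (b + w) φ)
    exact (congrArg (fun v => inner ℝ v (D.curlToLp φ)) hl').trans
      (hcomb.trans (congrArg (fun v => inner ℝ v (D.testToLp φ)) hsum.symm))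

end
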